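/- Let $\sigma_1=\begin{pmatrix}0&1\\1&0\end{pmatrix}$, $\sigma_2=\begin{pmatrix}0&-i\\i&0\end{pmatrix}$, $\sigma_3=\begin{pmatrix}1&0\\0&-1\end{pmatrix}$ be the Pauli matrices, let $\alpha_j=\begin{pmatrix}\mathbf 0&\sigma_j\\ \sigma_j&\mathbf 0\end{pmatrix}$ ($j=1,2,3$) be the $4\times4$ Dirac matrices, and put $\alpha\cdot v=\sum_{j=1}^3 v_j\alpha_j$ for $v \in \mathbb R^3$, $D=\frac1i\nabla_x$ on $\mathbb R^3$, and $\langle x\rangle=\sqrt{1+|x|^2}$. Let $Q(x)=(q_{jk}(x))$ be a $4\times 4$ matrix-valued function on $\mathbb R^3$ with measurable entries such that $Q(x)$ is Hermitian for each $x\in\mathbb R^3$ and, for some constants $C$ and $\rho>1$, $|q_{jk}(x)|\le C\langle x\rangle^{-\rho}$ for all $x\in\mathbb R^3$ and $j,k=1,\dots,4$. Let $f\in [H^1(\mathbb R^3)]^4$ be a zero mode of $H=\alpha\cdot D+Q$, that is, $(\alpha\cdot D)f+Qf=0$ almost everywhere, with derivatives in the weak sense. Then $Qf$ is integrable on $\mathbb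 R^3$, $f$ has a continuous representative (again denoted by $f$), and for every $\omega\in\mathbb S^2$ $$\lim_{r\to+\infty}r^2f(r\omega)=-\frac{i}{4\pi}\,(\alpha\cdot\omega)\int_{\mathbb R^3}Q(y)f(y)\,dy,$$ where the convergence is uniform with respect to $\omega\in\mathbb S^2$. -/

import Mathlib

open MeasureTheory Filter
open scoped Matrix Topology

noncomputable section

namespace ZeroMode

/-- Euclidean three-space, with Lebesgue measure as its volume. -/
abbrev E3 : Type := EuclideanSpace ℝ (Fin 3)

/-- The Japanese bracket `⟨x⟩ = √(1 + |x|²)`. -/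
def bracket (x : E3) : ℝ := Real.sqrt (1 + ‖x‖ ^ 2)

/-- The Pauli matrices. -/
def pauli : Fin 3 → Matrix (Fin 2) (Fin 2) ℂ :=
  ![!![0, 1; 1, 0], !![0, -Complex.I; Complex.I, 0], !![1, 0; 0, -1]]

/-- The Dirac matrices: the `4 × 4` matrices with zero diagonal blocks and both off-diagonal
`2 × 2` blocks equal to the corresponding Pauli matrix. -/
def alpha (j : Fin 3) : Matrix (Fin 4) (Fin 4) ℂ :=
  Matrix.reindex finSumFinEquiv finSumFinEquiv (Matrix.fromBlocks 0 (pauli j) (pauli j) 0)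

/-- `α · v = ∑ⱼ vⱼ αⱼ`. -/
def alphaDot (v : E3) : Matrix (Fin 4) (Fin 4) ℂ :=
  ∑ j : Fin 3, (v j : ℂ) • alpha j

/-- `v` is the weak (distributional) partial derivative `∂u/∂xⱼ` of `u` on `ℝ³`. -/
def HasWeakPartialDeriv (j : Fin 3) (u v : E3 → ℂ) : Prop :=
  LocallyIntegrable u ∧ LocallyIntegrable v ∧
    ∀ φ : E3 → ℝ, ContDiff ℝ ((⊤ : ℕ∞) : WithTop ℕ∞) φ → HasCompactSupport φ →
      ∫ x, u x * (fderiv ℝ φ x (EuclideanSpace.single j 1) : ℂ) = -∫ x, v x * (φ x : ℂ)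

/-- The Sobolev space `H¹(ℝ³)`: square integrable functions whose weak first partial derivatives
exist and are square integrable. -/
def MemH1 (u : E3 → ℂ) : Prop :=
  MemLp u 2 ∧ ∀ j : Fin 3, ∃ v : E3 → ℂ, MemLp v 2 ∧ HasWeakPartialDeriv j u v

/-- `h = (α · D + Q) f` almost everywhere, where `D = (1/i) ∇` is taken in the weak sense; the
function `Df j` has as its components the weak derivatives `∂f_k/∂xⱼ`, which are unique almost
everywhere. -/
def HasDiracImage (Q : E3 → Matrix (Fin 4) (Fin 4) ℂ) (f h : E3 → Fin 4 → ℂ) : Prop :=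
  ∃ Df : Fin 3 → E3 → Fin 4 → ℂ,
    (∀ j k, HasWeakPartialDeriv j (fun x => f x k) (fun x => Df j x k)) ∧
    ∀ᵐ x, h x = (∑ j : Fin 3, alpha j *ᵥ ((1 / Complex.I) • Df j x)) + Q x *ᵥ f x

/-- `f` is (a representative of) a zero mode of `H = α · D + Q`: it lies in `[H¹(ℝ³)]⁴`, the
domain of `H`, and `H f = 0`. -/
def IsZeroMode (Q : E3 → Matrix (Fin 4) (Fin 4) ℂ) (f : E3 → Fin 4 → ℂ) : Prop :=
  (∀ k, MemH1 (fun x => f x k)) ∧ HasDiracImage Q f 0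

end ZeroMode

end

/-!
A zero mode satisfies `(α · D) f = h` with `h = -Qf`. Testing this equation against the curl-free
fields `y ↦ Ψ (x - y)`, where `Ψ` is the Newton field `z / |z|³` smoothly cut off near `0` and near
`∞`, and letting the cutoffs disappear, represents `f` almost everywhere as the potential
`(i/4π) ∫ α · (x - y) / |x - y|³ h(y) dy`; divergences of the cut-off fields are approximate
identities of mass `4π`.

The same identity first gives the a priori bound `|f| ≤ 12 |·|⁻² * |Qf|`. Since
`|Qf| ≲ ⟨·⟩^(-ρ) |f|` with `ρ > 1`, this can be iterated: `f ∈ L²` becomes `f ∈ L^∞`, and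
boundedness becomes decay of any order below `2`. Hence `h` decays faster than `|y|⁻³`, which makes
the potential Hölder continuous. Its asymptotics follow from
`|N(x - y) - N(x)| ≤ |y| (|x - y|⁻² |x|⁻¹ + |x - y|⁻¹ |x|⁻²)` for the Newton field `N`, as the
convolutions of `|y|^(1 - b)` with `|y|⁻²` and `|y|⁻¹`, where `3 < b < 4`, make the error
`O(|x|^(1 - b)) = o(|x|⁻²)`.
-/

noncomputable section

namespace ZeroMode

open Metric Module
open scoped ENNReal Pointwise

section Riesz

variable {E : Type*} [NormedAddCommGroup E]

/-- The Riesz kernel `|z|⁻ᵖ`, with values in `[0, ∞]`. -/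
def riesz (p : ℝ) (z : E) : ℝ≥0∞ := ‖z‖ₑ ^ (-p)

lemma riesz_eq_ofReal (p : ℝ) {z : E} (hz : z ≠ 0) :
    riesz p z = ENNReal.ofReal (‖z‖ ^ (-p)) := by
  rw [riesz, ← ofReal_norm, ENNReal.ofReal_rpow_of_pos (norm_pos_iff.2 hz)]

lemma riesz_ne_top (p : ℝ) {z : E} (hz : z ≠ 0) : riesz p z ≠ ∞ := by
  simp [riesz_eq_ofReal p hz]

lemma riesz_zero (z : E) : riesz 0 z = 1 := by simp [riesz]

lemma riesz_mul_riesz (p q : ℝ) {z : E} (hz : z ≠ 0) :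
    riesz p z * riesz q z = riesz (p + q) z := by
  rw [riesz, riesz, riesz, ← ENNReal.rpow_add _ _ (by simpa using hz) (by simp), neg_add]

lemma riesz_le_riesz_of_norm_le {p : ℝ} (hp : 0 ≤ p) {y z : E} (h : ‖y‖ ≤ ‖z‖) :
    riesz p z ≤ riesz p y := by
  rw [riesz, riesz, ENNReal.rpow_neg, ENNReal.rpow_neg, ENNReal.inv_le_inv]
  exact ENNReal.rpow_le_rpow (enorm_le_iff_norm_le.2 h) hp

lemma riesz_le_of_le_norm {p t : ℝ} (hp : 0 ≤ p) {z : E} (h : t ≤ ‖z‖) :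
    riesz p z ≤ ENNReal.ofReal t ^ (-p) := by
  rw [riesz, ENNReal.rpow_neg, ENNReal.rpow_neg, ENNReal.inv_le_inv, ← ofReal_norm]
  gcongr

lemma riesz_mul_riesz_le {p q : ℝ} (hp : 0 ≤ p) (hq : 0 ≤ q) {y z : E} (hy : y ≠ 0)
    (hz : z ≠ 0) : riesz p y * riesz q z ≤ riesz (p + q) y + riesz (p + q) z := by
  rcases le_total ‖y‖ ‖z‖ with h | h
  · rw [← riesz_mul_riesz p q hy]
    exact (mul_le_mul_right (riesz_le_riesz_of_norm_le hq h) _).trans le_self_add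
  · rw [← riesz_mul_riesz p q hz]
    exact (mul_le_mul_left (riesz_le_riesz_of_norm_le hp h) _).trans le_add_self

/-- The decay profile `min 1 |y|⁻ᵖ`, comparable to `⟨y⟩⁻ᵖ` for `p ≥ 0`. -/
def decayWeight (p : ℝ) (y : E) : ℝ≥0∞ := min 1 (riesz p y)

lemma decayWeight_le_one (p : ℝ) (y : E) : decayWeight p y ≤ 1 := min_le_left _ _

lemma decayWeight_le_riesz {p q : ℝ} (hp : 0 ≤ p) (hpq : p ≤ q) (y : E) :
    decayWeight q y ≤ riesz p y := by
  rcases le_total ‖y‖ₑ 1 with h | h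
  · refine (decayWeight_le_one q y).trans ?_
    rw [riesz, ENNReal.rpow_neg, ENNReal.one_le_inv]
    exact ENNReal.rpow_le_one h hp
  · refine (min_le_right _ _).trans ?_
    rw [riesz, riesz]
    exact ENNReal.rpow_le_rpow_of_exponent_le h (neg_le_neg hpq)

lemma decayWeight_mul_decayWeight_le (p q : ℝ) {y : E} (hy : y ≠ 0) :
    decayWeight p y * decayWeight q y ≤ decayWeight (p + q) y := by
  refine le_min (mul_le_one' (decayWeight_le_one p y) (decayWeight_le_one q y)) ?_
  rw [← riesz_mul_riesz p q hy]
  exact mul_le_mul' (min_le_right _ _) (min_le_right _ _)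

variable [MeasurableSpace E] [BorelSpace E]

@[fun_prop]
lemma measurable_riesz (p : ℝ) : Measurable (riesz p : E → ℝ≥0∞) :=
  measurable_enorm.pow_const _

@[fun_prop]
lemma measurable_decayWeight (p : ℝ) : Measurable (decayWeight p : E → ℝ≥0∞) :=
  measurable_const.min (measurable_riesz p)

variable [NormedSpace ℝ E] [FiniteDimensional ℝ E] (μ : Measure E) [μ.IsAddHaarMeasure]

lemma setLIntegral_smul_set {t : ℝ} (ht : 0 < t) (F : E → ℝ≥0∞) (s : Set E) :
    ∫⁻ z in t • s, F z ∂μ = ENNReal.ofReal (t ^ finrank ℝ E) * ∫⁻ z in s, F (t • z) ∂μ := by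
  have hemb : MeasurableEmbedding fun z : E => t • z := measurableEmbedding_const_smul₀ ht.ne'
  have hmap : ∫⁻ z in s, F (t • z) ∂μ =
      ENNReal.ofReal (t ^ finrank ℝ E)⁻¹ * ∫⁻ z in t • s, F z ∂μ := by
    rw [← abs_of_pos (show 0 < (t ^ finrank ℝ E)⁻¹ by positivity), ← smul_eq_mul,
      ← lintegral_smul_measure, ← Measure.restrict_smul, ← Measure.map_addHaar_smul μ ht.ne',
      hemb.restrict_map, hemb.lintegral_map, Set.preimage_smul₀ ht.ne', inv_smul_smul₀ ht.ne']
  rw [hmap, ← mul_assoc, ← ENNReal.ofReal_mul (by positivity),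
    mul_inv_cancel₀ (by positivity), ENNReal.ofReal_one, one_mul]

lemma setLIntegral_riesz_smul_set (p : ℝ) {t : ℝ} (ht : 0 < t) (s : Set E) :
    ∫⁻ z in t • s, riesz p z ∂μ =
      ENNReal.ofReal t ^ (finrank ℝ E - p) * ∫⁻ z in s, riesz p z ∂μ := by
  have hscale : ∀ z : E, riesz p (t • z) = ENNReal.ofReal t ^ (-p) * riesz p z := by
    intro z
    rw [riesz, riesz, enorm_smul, Real.enorm_eq_ofReal ht.le,
      ENNReal.mul_rpow_of_ne_top (by simp) (by simp)]
  rw [setLIntegral_smul_set μ ht, lintegral_congr hscale,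
    lintegral_const_mul _ (measurable_riesz p), ← mul_assoc, sub_eq_add_neg,
    ENNReal.rpow_add _ _ (by simpa) (by simp), ENNReal.rpow_natCast, ENNReal.ofReal_pow ht.le]

lemma lintegral_riesz_ball {p t : ℝ} (ht : 0 < t) :
    ∫⁻ z in ball 0 t, riesz p z ∂μ =
      ENNReal.ofReal t ^ (finrank ℝ E - p) * ∫⁻ z in ball 0 1, riesz p z ∂μ := by
  rw [← setLIntegral_riesz_smul_set μ p ht, smul_unitBall_of_pos ht]

lemma lintegral_riesz_compl_ball {p t : ℝ} (ht : 0 < t) :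
    ∫⁻ z in (ball 0 t)ᶜ, riesz p z ∂μ =
      ENNReal.ofReal t ^ (finrank ℝ E - p) * ∫⁻ z in (ball 0 1)ᶜ, riesz p z ∂μ := by
  have hcompl : t • (ball (0 : E) 1)ᶜ = (t • ball 0 1)ᶜ :=
    Set.image_compl_eq (MulAction.bijective₀ ht.ne')
  rw [← setLIntegral_riesz_smul_set μ p ht, hcompl, smul_unitBall_of_pos ht]

lemma lintegral_riesz_compl_unitBall_ne_top {p : ℝ} (hp : finrank ℝ E < p) :
    ∫⁻ z in (ball (0 : E) 1)ᶜ, riesz p z ∂μ ≠ ∞ := by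
  have hp0 : 0 < p := (Nat.cast_nonneg _).trans_lt hp
  have hle : ∀ z ∈ (ball (0 : E) 1)ᶜ,
      riesz p z ≤ ENNReal.ofReal (2 ^ p) * ENNReal.ofReal ((1 + ‖z‖) ^ (-p)) := by
    intro z hz
    have hz1 : 1 ≤ ‖z‖ := by simpa using hz
    rw [riesz_eq_ofReal p (norm_pos_iff.1 (by linarith)), ← ENNReal.ofReal_mul (by positivity)]
    refine ENNReal.ofReal_le_ofReal ?_
    rw [Real.rpow_neg (by positivity), Real.rpow_neg (by positivity), ← div_eq_mul_inv,
      ← Real.div_rpow (by positivity) (by positivity), ← Real.inv_rpow (by positivity)]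
    gcongr
    rw [inv_eq_one_div, div_le_div_iff₀ (by positivity) (by positivity)]
    linarith
  refine ne_top_of_le_ne_top ?_ ((setLIntegral_mono' measurableSet_ball.compl hle).trans
    (setLIntegral_le_lintegral _ _))
  rw [lintegral_const_mul' _ _ ENNReal.ofReal_ne_top]
  exact ENNReal.mul_ne_top ENNReal.ofReal_ne_top (finite_integral_one_add_norm hp).ne

lemma lintegral_decayWeight_ne_top {p : ℝ} (hp : finrank ℝ E < p) :
    ∫⁻ y, decayWeight p y ∂μ ≠ ∞ := by
  rw [← lintegral_add_compl _ (measurableSet_ball (x := (0 : E)) (ε := 1)), ENNReal.add_ne_top]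
  refine ⟨ne_top_of_le_ne_top ?_ (lintegral_mono (decayWeight_le_one p)),
    ne_top_of_le_ne_top (lintegral_riesz_compl_unitBall_ne_top μ hp)
      (lintegral_mono fun _ => min_le_right _ _)⟩
  simpa using measure_ball_lt_top.ne

variable [Nontrivial E]

lemma ae_ne_zero : ∀ᵐ z ∂μ, z ≠ 0 := by
  simp [ae_iff]

lemma ae_sub_ne_zero (x : E) : ∀ᵐ y ∂μ, x - y ≠ 0 := by
  simp [ae_iff, sub_eq_zero]

lemma lintegral_riesz_unitBall_ne_top {p : ℝ} (hp : p < finrank ℝ E) :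
    ∫⁻ z in ball (0 : E) 1, riesz p z ∂μ ≠ ∞ := by
  have hint : IntegrableOn (fun z : E => ‖z‖ ^ (-p)) (ball 0 1) μ := by
    refine integrableOn_ball_of_norm_le_rpow (C := 1) (α := p) finrank_pos hp ?_ ?_
    · refine ae_of_all _ fun z => ?_
      rw [Real.norm_of_nonneg (by positivity), one_mul]
    · exact (measurable_norm.pow_const _).aestronglyMeasurable
  refine (hint.lintegral_lt_top.trans_le' (lintegral_mono_ae ?_)).ne
  filter_upwards [ae_restrict_of_ae (ae_ne_zero μ)] with z hz using (riesz_eq_ofReal p hz).le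

-- Near `x` the factor `g` is bounded by `M`, near `0` the kernel is bounded by `t⁻ᵖ`, and
-- elsewhere the factor with the smaller argument controls the product.
lemma lintegral_riesz_mul_le {p q t : ℝ} (hp : 0 ≤ p) (hq : 0 ≤ q) (ht : 0 < t) {x : E}
    {g : E → ℝ≥0∞} {M : ℝ≥0∞} (hg : ∀ y, g y ≤ riesz q y) (hM : ∀ y ∈ ball x t, g y ≤ M) :
    ∫⁻ y, riesz p (x - y) * g y ∂μ ≤ M * ∫⁻ z in ball 0 t, riesz p z ∂μ
      + ENNReal.ofReal t ^ (-p) * ∫⁻ y in ball 0 t, g y ∂μ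
      + 2 * ∫⁻ z in (ball 0 t)ᶜ, riesz (p + q) z ∂μ := by
  set near : E → ℝ≥0∞ := (ball 0 t).indicator (riesz p) with hnear
  set far : E → ℝ≥0∞ := (ball 0 t)ᶜ.indicator (riesz (p + q)) with hfar
  have hnear_meas : Measurable near := (measurable_riesz p).indicator measurableSet_ball
  have hfar_meas : Measurable far := (measurable_riesz _).indicator measurableSet_ball.compl
  have hpointwise : ∀ᵐ y ∂μ, riesz p (x - y) * g y ≤ M * near (x - y) + (far (x - y) +
      (far y + ENNReal.ofReal t ^ (-p) * (ball 0 t).indicator g y)) := by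
    filter_upwards [ae_ne_zero μ, ae_sub_ne_zero μ x] with y hy hxy
    by_cases hx : x - y ∈ ball 0 t
    · refine le_trans ?_ le_self_add
      rw [hnear, Set.indicator_of_mem hx, mul_comm M]
      exact mul_le_mul_right (hM y (by simpa [dist_eq_norm, norm_sub_rev] using hx)) _
    have hxt : t ≤ ‖x - y‖ := by simpa using hx
    refine le_trans ?_ le_add_self
    by_cases hy0 : y ∈ ball 0 t
    · rw [Set.indicator_of_mem hy0]
      exact (mul_le_mul_left (riesz_le_of_le_norm hp hxt) _).trans
        (le_add_self.trans le_add_self)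
    · rw [hfar, Set.indicator_of_mem hx, Set.indicator_of_mem hy0, ← add_assoc]
      exact ((mul_le_mul_right (hg y) _).trans (riesz_mul_riesz_le hp hq hxy hy)).trans
        le_self_add
  refine (lintegral_mono_ae hpointwise).trans_eq ?_
  have ht_top : ENNReal.ofReal t ^ (-p) ≠ ∞ := by simp [ht]
  rw [lintegral_add_left (by fun_prop), lintegral_add_left (by fun_prop),
    lintegral_add_left (by fun_prop), lintegral_const_mul _ (by fun_prop),
    lintegral_const_mul' _ _ ht_top, lintegral_sub_left_eq_self, lintegral_sub_left_eq_self,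
    hnear, hfar, lintegral_indicator measurableSet_ball, lintegral_indicator measurableSet_ball,
    lintegral_indicator measurableSet_ball.compl]
  ring

lemma exists_lintegral_riesz_mul_riesz_le {p q : ℝ} (hp : 0 ≤ p) (hpd : p < finrank ℝ E)
    (hq : 0 ≤ q) (hqd : q < finrank ℝ E) (hpq : finrank ℝ E < p + q) :
    ∃ C : ℝ≥0∞, C ≠ ∞ ∧ ∀ x : E, x ≠ 0 →
      ∫⁻ y, riesz p (x - y) * riesz q y ∂μ ≤ C * riesz (p + q - finrank ℝ E) x := by
  set S := (∫⁻ z in ball (0 : E) 1, riesz p z ∂μ) + (∫⁻ z in ball (0 : E) 1, riesz q z ∂μ)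
    + 2 * ∫⁻ z in (ball (0 : E) 1)ᶜ, riesz (p + q) z ∂μ
  have hS : S ≠ ∞ := by
    simp [S, ENNReal.add_eq_top, ENNReal.mul_eq_top, lintegral_riesz_unitBall_ne_top μ hpd,
      lintegral_riesz_unitBall_ne_top μ hqd, lintegral_riesz_compl_unitBall_ne_top μ hpq]
  refine ⟨ENNReal.ofReal 2⁻¹ ^ (-(p + q - finrank ℝ E)) * S, ENNReal.mul_ne_top (by simp) hS,
    fun x hx => ?_⟩
  have : 0 < ‖x‖ := norm_pos_iff.2 hx
  set t : ℝ := 2⁻¹ * ‖x‖ with htx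
  have ht : 0 < t := by positivity
  have hnear : ∀ y ∈ ball x t, riesz q y ≤ ENNReal.ofReal t ^ (-q) := by
    intro y hy
    have htriangle : ‖x‖ - ‖y‖ ≤ ‖y - x‖ := norm_sub_rev x y ▸ norm_sub_norm_le x y
    have hyx : ‖y - x‖ < t := mem_ball_iff_norm.1 hy
    exact riesz_le_of_le_norm hq (by linarith)
  have hpow : ∀ r s : ℝ, ENNReal.ofReal t ^ r * ENNReal.ofReal t ^ s
      = ENNReal.ofReal t ^ (r + s) := fun r s =>
    (ENNReal.rpow_add r s (by simpa) ENNReal.ofReal_ne_top).symm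
  refine (lintegral_riesz_mul_le μ hp hq ht (fun _ => le_rfl) hnear).trans_eq ?_
  calc _ = ENNReal.ofReal t ^ (-(p + q - finrank ℝ E)) * S := by
        rw [lintegral_riesz_ball μ ht, lintegral_riesz_ball μ ht, lintegral_riesz_compl_ball μ ht,
          mul_left_comm 2, ← mul_assoc, ← mul_assoc, hpow, hpow, mul_add, mul_add]
        ring_nf
    _ = _ := by
        rw [htx, ENNReal.ofReal_mul (by positivity), ofReal_norm,
          ENNReal.mul_rpow_of_ne_top (by simp) (by simp), mul_right_comm, riesz]

lemma exists_lintegral_riesz_mul_decayWeight_le {p q : ℝ} (hp : 0 ≤ p) (hpd : p < finrank ℝ E)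
    (hq : 0 ≤ q) (hpq : finrank ℝ E < p + q) :
    ∃ C : ℝ≥0∞, C ≠ ∞ ∧ ∀ x : E, ∫⁻ y, riesz p (x - y) * decayWeight q y ∂μ ≤ C := by
  refine ⟨_, ?_, fun x => lintegral_riesz_mul_le μ hp hq one_pos
    (fun y => decayWeight_le_riesz hq le_rfl y) (fun y _ => decayWeight_le_one q y)⟩
  have hball : ∫⁻ y in ball (0 : E) 1, decayWeight q y ∂μ ≠ ∞ :=
    ne_top_of_le_ne_top (by simpa using measure_ball_lt_top.ne)
      (lintegral_mono (decayWeight_le_one q))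
  simp [ENNReal.add_eq_top, ENNReal.mul_eq_top, hball, lintegral_riesz_unitBall_ne_top μ hpd,
    lintegral_riesz_compl_unitBall_ne_top μ hpq]

end Riesz

section Bootstrap

variable {E : Type*} [NormedAddCommGroup E] [NormedSpace ℝ E] [FiniteDimensional ℝ E]
  [MeasurableSpace E] [BorelSpace E] (μ : Measure E) [μ.IsAddHaarMeasure]

lemma lintegral_riesz_mul_lintegral_riesz_mul (p q : ℝ) (x : E) {v : E → ℝ≥0∞}
    (hv : AEMeasurable v μ) :
    ∫⁻ y, riesz p (x - y) * ∫⁻ z, riesz q (y - z) * v z ∂μ ∂μ =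
      ∫⁻ z, (∫⁻ y, riesz p (x - z - y) * riesz q y ∂μ) * v z ∂μ := by
  have hmeas : AEMeasurable (Function.uncurry fun y z : E =>
      riesz p (x - y) * (riesz q (y - z) * v z)) (μ.prod μ) := by
    have hp : Measurable fun w : E × E => riesz p (x - w.1) := by fun_prop
    have hq : Measurable fun w : E × E => riesz q (w.1 - w.2) := by fun_prop
    exact hp.aemeasurable.mul (hq.aemeasurable.mul hv.comp_snd)
  calc _ = ∫⁻ y, ∫⁻ z, riesz p (x - y) * (riesz q (y - z) * v z) ∂μ ∂μ := by
        refine lintegral_congr fun y => (lintegral_const_mul'' _ ?_).symm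
        exact (by fun_prop : Measurable fun z => riesz q (y - z)).aemeasurable.mul hv
    _ = ∫⁻ z, ∫⁻ y, riesz p (x - y) * riesz q (y - z) * v z ∂μ ∂μ := by
        simp only [lintegral_lintegral_swap hmeas, mul_assoc]
    _ = ∫⁻ z, (∫⁻ y, riesz p (x - z - y) * riesz q y ∂μ) * v z ∂μ := by
        refine lintegral_congr fun z => ?_
        rw [lintegral_mul_const _ (by fun_prop),
          ← lintegral_sub_right_eq_self (fun y => riesz p (x - z - y) * riesz q y) z]
        simp only [sub_sub_sub_cancel_right]

lemma mul_le_sq_add_sq (a b : ℝ≥0∞) : a * b ≤ a ^ 2 + b ^ 2 := by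
  rcases le_total a b with h | h
  · exact (mul_le_mul_left h b).trans ((sq b).symm.le.trans le_add_self)
  · exact (mul_le_mul_right h a).trans ((sq a).symm.le.trans le_self_add)

variable [Nontrivial E] {p ρ : ℝ} {A : ℝ≥0∞} {u : E → ℝ≥0∞}

lemma exists_ae_le_of_le_lintegral_riesz (hp : finrank ℝ E < 2 * p) (hp' : 4 * p < 3 * finrank ℝ E)
    (hρ : finrank ℝ E - p < ρ) (hA : A ≠ ∞) (hu_meas : AEMeasurable u μ)
    (hu_sq : ∫⁻ y, u y ^ 2 ∂μ ≠ ∞)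
    (hu : ∀ᵐ x ∂μ, u x ≤ A * ∫⁻ y, riesz p (x - y) * (decayWeight ρ y * u y) ∂μ) :
    ∃ B : ℝ≥0∞, B ≠ ∞ ∧ ∀ᵐ x ∂μ, u x ≤ B := by
  set d : ℝ := (finrank ℝ E : ℝ)
  have : 0 < d := by simp [d, finrank_pos]
  obtain ⟨C, hC, hconv⟩ := exists_lintegral_riesz_mul_riesz_le μ (p := p) (q := p)
    (by linarith) (by linarith) (by linarith) (by linarith) (by linarith)
  obtain ⟨C', hC', hsq⟩ := exists_lintegral_riesz_mul_decayWeight_le μ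
    (p := 2 * (p + p - d)) (q := 2 * ρ) (by linarith) (by linarith) (by linarith) (by linarith)
  refine ⟨A * (A * (C * (C' + ∫⁻ y, u y ^ 2 ∂μ))), by finiteness, ?_⟩
  filter_upwards [hu] with x hx
  have hiter : ∫⁻ y, riesz p (x - y) * (decayWeight ρ y * u y) ∂μ ≤
      A * ∫⁻ y, riesz p (x - y) * ∫⁻ z, riesz p (y - z) * (decayWeight ρ z * u z) ∂μ ∂μ := by
    rw [← lintegral_const_mul' _ _ hA]
    refine lintegral_mono_ae ?_
    filter_upwards [hu] with y hy
    rw [mul_left_comm A]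
    exact mul_le_mul_right ((mul_le_of_le_one_left' (decayWeight_le_one ρ y)).trans hy) _
  refine hx.trans (mul_le_mul_right (hiter.trans (mul_le_mul_right ?_ _)) _)
  calc ∫⁻ y, riesz p (x - y) * ∫⁻ z, riesz p (y - z) * (decayWeight ρ z * u z) ∂μ ∂μ
      = ∫⁻ z, (∫⁻ y, riesz p (x - z - y) * riesz p y ∂μ) * (decayWeight ρ z * u z) ∂μ :=
        lintegral_riesz_mul_lintegral_riesz_mul μ p p x
          ((measurable_decayWeight ρ).aemeasurable.mul hu_meas)
    _ ≤ ∫⁻ z, C * (riesz (2 * (p + p - d)) (x - z) * decayWeight (2 * ρ) z + u z ^ 2) ∂μ := by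
        refine lintegral_mono_ae ?_
        filter_upwards [ae_sub_ne_zero μ x, ae_ne_zero μ] with z hxz hz
        refine (mul_le_mul_left (hconv _ hxz) _).trans ?_
        rw [mul_assoc, ← mul_assoc (riesz _ _), two_mul, two_mul]
        refine mul_le_mul_right ((mul_le_sq_add_sq _ _).trans ?_) _
        rw [mul_pow, sq (riesz _ _), riesz_mul_riesz _ _ hxz, sq (decayWeight _ _)]
        gcongr
        exact decayWeight_mul_decayWeight_le ρ ρ hz
    _ ≤ C * (C' + ∫⁻ y, u y ^ 2 ∂μ) := by
        rw [lintegral_const_mul' _ _ hC, lintegral_add_left (by fun_prop)]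
        gcongr
        exact hsq x

lemma exists_ae_le_riesz_of_ae_le_riesz {a s : ℝ} {B : ℝ≥0∞} (hB : B ≠ ∞) (hp : 0 ≤ p)
    (hpd : p < finrank ℝ E) (hs : 0 ≤ s) (hsρ : s ≤ ρ)
    (has : a + s < finrank ℝ E) (hpas : finrank ℝ E < p + (a + s)) (hA : A ≠ ∞)
    (hu : ∀ᵐ x ∂μ, u x ≤ A * ∫⁻ y, riesz p (x - y) * (decayWeight ρ y * u y) ∂μ)
    (hua : ∀ᵐ x ∂μ, u x ≤ B * riesz a x) :
    ∃ B' : ℝ≥0∞, B' ≠ ∞ ∧ ∀ᵐ x ∂μ, u x ≤ B' * riesz (p + (a + s) - finrank ℝ E) x := by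
  obtain ⟨C, hC, hconv⟩ := exists_lintegral_riesz_mul_riesz_le μ (p := p) (q := a + s)
    hp hpd (by linarith) has hpas
  refine ⟨A * (B * C), by finiteness, ?_⟩
  filter_upwards [hu, ae_ne_zero μ] with x hx hx0
  refine hx.trans ?_
  rw [mul_assoc, mul_assoc]
  refine mul_le_mul_right ?_ _
  calc ∫⁻ y, riesz p (x - y) * (decayWeight ρ y * u y) ∂μ
      ≤ ∫⁻ y, B * (riesz p (x - y) * riesz (a + s) y) ∂μ := by
        refine lintegral_mono_ae ?_
        filter_upwards [hua, ae_ne_zero μ] with y hy hy0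
        rw [mul_left_comm B, add_comm a, ← riesz_mul_riesz s a hy0, mul_left_comm B]
        gcongr
        exact decayWeight_le_riesz hs hsρ y
    _ ≤ B * (C * riesz (p + (a + s) - finrank ℝ E) x) := by
        rw [lintegral_const_mul' _ _ hB]
        exact mul_le_mul_right (hconv x hx0) _

lemma exists_ae_le_riesz {a : ℝ} {B : ℝ≥0∞} (hB : B ≠ ∞) (ha : 0 < a) (hap : a < p)
    (hpd : p < finrank ℝ E) (hρ : finrank ℝ E - p < ρ) (hA : A ≠ ∞)
    (hu : ∀ᵐ x ∂μ, u x ≤ A * ∫⁻ y, riesz p (x - y) * (decayWeight ρ y * u y) ∂μ)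
    (hu_bdd : ∀ᵐ x ∂μ, u x ≤ B) :
    ∃ B' : ℝ≥0∞, B' ≠ ∞ ∧ ∀ᵐ x ∂μ, u x ≤ B' * riesz a x := by
  obtain ⟨n, hn⟩ := exists_nat_gt (a / (ρ - (finrank ℝ E - p)))
  have hgap : 0 < ρ - (finrank ℝ E - p) := by linarith
  have hn0 : (0 : ℝ) < n := (div_pos ha hgap).trans hn
  have hstep : a / n < ρ - (finrank ℝ E - p) := by rwa [div_lt_comm₀ hn0 hgap]
  have hstep0 : 0 < a / n := by positivity
  have hiter : ∀ k ≤ n, ∃ B' : ℝ≥0∞, B' ≠ ∞ ∧ ∀ᵐ x ∂μ, u x ≤ B' * riesz (k * (a / n)) x := by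
    intro k
    induction k with
    | zero => exact fun _ => ⟨B, hB, by simpa [riesz_zero] using hu_bdd⟩
    | succ k ih =>
      intro hk
      obtain ⟨B', hB', hk_le⟩ := ih (by omega)
      have hka : ((k + 1 : ℕ) : ℝ) * (a / n) ≤ a := by
        rw [← mul_div_assoc, div_le_iff₀ hn0, mul_comm]
        gcongr
      push_cast at hka ⊢
      have hk0 : 0 ≤ k * (a / n) := by positivity
      have hexp : (k + 1) * (a / n) =
          p + (k * (a / n) + (a / n + (finrank ℝ E - p))) - finrank ℝ E := by ring
      rw [hexp]
      exact exists_ae_le_riesz_of_ae_le_riesz μ hB' (by linarith) hpd (by linarith)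
        (by linarith) (by linarith) (by linarith) hA hu hk_le
  simpa [mul_div_cancel₀, hn0.ne'] using hiter n le_rfl

lemma exists_decayWeight_mul_le_decayWeight (hp : finrank ℝ E < 2 * p)
    (hp' : 4 * p < 3 * finrank ℝ E) (hρ : finrank ℝ E - p < ρ) (hA : A ≠ ∞)
    (hu_meas : AEMeasurable u μ) (hu_sq : ∫⁻ y, u y ^ 2 ∂μ ≠ ∞)
    (hu : ∀ᵐ x ∂μ, u x ≤ A * ∫⁻ y, riesz p (x - y) * (decayWeight ρ y * u y) ∂μ) :
    ∃ b : ℝ, finrank ℝ E < b ∧ ∃ B : ℝ≥0∞, B ≠ ∞ ∧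
      ∀ᵐ y ∂μ, decayWeight ρ y * u y ≤ B * decayWeight b y := by
  obtain ⟨B, hB, hu_bdd⟩ := exists_ae_le_of_le_lintegral_riesz μ hp hp' hρ hA hu_meas hu_sq hu
  have : (0 : ℝ) < finrank ℝ E := by simp [finrank_pos]
  obtain ⟨a, ha, hap⟩ := exists_between
    (show max 0 (finrank ℝ E - ρ) < p from max_lt (by linarith) (by linarith))
  rw [max_lt_iff] at ha
  obtain ⟨B', hB', hua⟩ := exists_ae_le_riesz μ hB ha.1 hap (by linarith) hρ hA hu hu_bdd
  refine ⟨ρ + a, by linarith, B + B', by finiteness, ?_⟩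
  filter_upwards [hu_bdd, hua, ae_ne_zero μ] with y hyB hya hy0
  rw [decayWeight, decayWeight, mul_min]
  refine le_min ?_ ?_
  · rw [mul_one]
    exact (mul_le_of_le_one_left' (min_le_left _ _)).trans (hyB.trans le_self_add)
  · rw [← riesz_mul_riesz ρ a hy0, mul_left_comm]
    exact mul_le_mul' (min_le_right _ _) (hya.trans (mul_le_mul_left le_add_self _))

end Bootstrap

section DiracMatrices

lemma pauli_mul_pauli_add (m j : Fin 3) :
    pauli m * pauli j + pauli j * pauli m = if m = j then (2 : ℂ) • 1 else 0 := by
  ext a b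
  fin_cases m <;> fin_cases j <;> fin_cases a <;> fin_cases b <;>
    simp [pauli, one_add_one_eq_two]

lemma alpha_eq_reindexAlgEquiv (j : Fin 3) : alpha j =
    Matrix.reindexAlgEquiv ℂ ℂ finSumFinEquiv (Matrix.fromBlocks 0 (pauli j) (pauli j) 0) :=
  rfl

lemma alpha_mul_alpha_add (m j : Fin 3) :
    alpha m * alpha j + alpha j * alpha m = if m = j then (2 : ℂ) • 1 else 0 := by
  rw [alpha_eq_reindexAlgEquiv, alpha_eq_reindexAlgEquiv, ← map_mul, ← map_mul, ← map_add,
    Matrix.fromBlocks_multiply, Matrix.fromBlocks_multiply, Matrix.fromBlocks_add]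
  simp only [zero_mul, mul_zero, add_zero, zero_add, pauli_mul_pauli_add]
  split_ifs
  · have hscalar : Matrix.fromBlocks ((2 : ℂ) • (1 : Matrix (Fin 2) (Fin 2) ℂ)) 0 0
        ((2 : ℂ) • (1 : Matrix (Fin 2) (Fin 2) ℂ)) = (2 : ℂ) • 1 := by
      rw [← Matrix.fromBlocks_one, Matrix.fromBlocks_smul, smul_zero]
    rw [hscalar, map_smul, map_one]
  · rw [Matrix.fromBlocks_zero, map_zero]

lemma sum_smul_alpha_mul_alpha {S : Fin 3 → Fin 3 → ℝ} (hS : ∀ m j, S m j = S j m) :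
    ∑ m, ∑ j, S m j • (alpha m * alpha j) = ∑ j, S j j • (1 : Matrix (Fin 4) (Fin 4) ℂ) := by
  have hswap : ∑ m, ∑ j, S m j • (alpha m * alpha j) = ∑ m, ∑ j, S m j • (alpha j * alpha m) := by
    rw [Finset.sum_comm]
    simp only [hS]
  refine smul_right_injective _ (two_ne_zero (α := ℝ)) ?_
  calc (2 : ℝ) • ∑ m, ∑ j, S m j • (alpha m * alpha j)
      = ∑ m, ∑ j, S m j • (alpha m * alpha j + alpha j * alpha m) := by
        simp only [two_smul, smul_add, Finset.sum_add_distrib, ← hswap]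
    _ = (2 : ℝ) • ∑ j, S j j • (1 : Matrix (Fin 4) (Fin 4) ℂ) := by
        simp only [alpha_mul_alpha_add, smul_ite, smul_zero, Finset.sum_ite_eq, Finset.mem_univ,
          if_true, Finset.smul_sum, ← one_add_one_eq_two, smul_add, add_smul, one_smul]

lemma norm_alpha_apply_le (j : Fin 3) (k l : Fin 4) : ‖alpha j k l‖ ≤ 1 := by
  have hpauli : ∀ a b, ‖pauli j a b‖ ≤ 1 := by
    intro a b
    fin_cases j <;> fin_cases a <;> fin_cases b <;> simp [pauli]
  obtain ⟨k, rfl⟩ := (finSumFinEquiv (m := 2) (n := 2)).surjective k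
  obtain ⟨l, rfl⟩ := (finSumFinEquiv (m := 2) (n := 2)).surjective l
  rcases k with k | k <;> rcases l with l | l <;> simp [alpha, hpauli]

lemma norm_mulVec_le {m n : Type*} [Fintype m] [Fintype n] {M : Matrix m n ℂ} {c : ℝ}
    (hc : 0 ≤ c) (hM : ∀ k l, ‖M k l‖ ≤ c) (u : n → ℂ) :
    ‖M *ᵥ u‖ ≤ Fintype.card n * c * ‖u‖ := by
  refine (pi_norm_le_iff_of_nonneg (by positivity)).2 fun k => ?_
  calc ‖(M *ᵥ u) k‖ ≤ ∑ l, ‖M k l * u l‖ := norm_sum_le _ _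
    _ ≤ ∑ _l : n, c * ‖u‖ := by
        gcongr with l
        rw [norm_mul]
        gcongr
        exacts [hM k l, norm_le_pi_norm u l]
    _ = Fintype.card n * c * ‖u‖ := by simp [mul_assoc]

lemma norm_alphaDot_mulVec_le (v : E3) (u : Fin 4 → ℂ) :
    ‖alphaDot v *ᵥ u‖ ≤ 12 * ‖v‖ * ‖u‖ := by
  have hentry : ∀ k l, ‖alphaDot v k l‖ ≤ 3 * ‖v‖ := by
    intro k l
    rw [alphaDot, Matrix.sum_apply]
    calc ‖∑ j, ((v j : ℂ) • alpha j) k l‖ ≤ ∑ j, ‖((v j : ℂ) • alpha j) k l‖ := norm_sum_le _ _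
      _ ≤ ∑ _j : Fin 3, ‖v‖ := by
          gcongr with j
          rw [Matrix.smul_apply, smul_eq_mul, norm_mul, Complex.norm_real]
          exact (mul_le_of_le_one_right (norm_nonneg _) (norm_alpha_apply_le j k l)).trans
            (PiLp.norm_apply_le v j)
      _ = 3 * ‖v‖ := by simp
  refine (norm_mulVec_le (by positivity) hentry u).trans_eq ?_
  rw [Fintype.card_fin]
  ring

lemma enorm_alphaDot_mulVec_le (v : E3) (u : Fin 4 → ℂ) :
    ‖alphaDot v *ᵥ u‖ₑ ≤ 12 * (‖v‖ₑ * ‖u‖ₑ) := by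
  have h := ENNReal.ofReal_le_ofReal (norm_alphaDot_mulVec_le v u)
  rwa [ENNReal.ofReal_mul (by positivity), ENNReal.ofReal_mul (by norm_num), ofReal_norm,
    ofReal_norm, ofReal_norm, ENNReal.ofReal_ofNat, mul_assoc] at h

lemma alphaDot_sub (v w : E3) : alphaDot (v - w) = alphaDot v - alphaDot w := by
  simp [alphaDot, sub_smul, Finset.sum_sub_distrib]

lemma alphaDot_smul (c : ℝ) (v : E3) : alphaDot (c • v) = (c : ℂ) • alphaDot v := by
  simp only [alphaDot, Finset.smul_sum, smul_smul, PiLp.smul_apply, smul_eq_mul,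
    Complex.ofReal_mul]

lemma aestronglyMeasurable_alphaDot_mulVec {X : Type*} [MeasurableSpace X] {μ : Measure X}
    {Φ : X → E3} {h : X → Fin 4 → ℂ} (hΦ : AEStronglyMeasurable Φ μ)
    (hh : AEStronglyMeasurable h μ) :
    AEStronglyMeasurable (fun y => alphaDot (Φ y) *ᵥ h y) μ := by
  simp only [alphaDot, Matrix.sum_mulVec, Matrix.smul_mulVec]
  fun_prop

end DiracMatrices

section IntegrationByParts

open scoped ContDiff

/-- The divergence of a vector field, as the trace of its derivative. -/
def divergence {E : Type*} [NormedAddCommGroup E] [NormedSpace ℝ E] (Φ : E → E) (y : E) : ℝ :=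
  LinearMap.trace ℝ E (fderiv ℝ Φ y)

variable {X ι m n : Type*} [MeasurableSpace X] {μ : Measure X} [Fintype ι] [Fintype m] [Fintype n]

lemma integrable_mulVec (M : Matrix m n ℂ) {v : X → n → ℂ} (hv : Integrable v μ) :
    Integrable (fun x => M *ᵥ v x) μ :=
  (LinearMap.toContinuousLinearMap M.mulVecLin).integrable_comp hv

lemma integral_mulVec (M : Matrix m n ℂ) {v : X → n → ℂ} (hv : Integrable v μ) :
    ∫ x, M *ᵥ v x ∂μ = M *ᵥ ∫ x, v x ∂μ :=
  (LinearMap.toContinuousLinearMap M.mulVecLin).integral_comp_comm hv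

lemma locallyIntegrable_of_eval {f : E3 → ι → ℂ} (hf : ∀ k, LocallyIntegrable fun x => f x k) :
    LocallyIntegrable f := by
  rw [locallyIntegrable_iff]
  exact fun K hK => Integrable.of_eval fun k => (hf k).integrableOn_isCompact hK

lemma integral_fderiv_smul_eq_neg {j : Fin 3} {f g : E3 → ι → ℂ}
    (hfg : ∀ k, HasWeakPartialDeriv j (fun x => f x k) (fun x => g x k)) {φ : E3 → ℝ}
    (hφ : ContDiff ℝ ∞ φ) (hc : HasCompactSupport φ) :
    ∫ y, fderiv ℝ φ y (EuclideanSpace.single j 1) • f y = -∫ y, φ y • g y := by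
  have hf : Integrable fun y => fderiv ℝ φ y (EuclideanSpace.single j 1) • f y :=
    (locallyIntegrable_of_eval fun k => (hfg k).1).integrable_smul_left_of_hasCompactSupport
      ((hφ.continuous_fderiv (by simp)).clm_apply continuous_const) (hc.fderiv_apply ℝ _)
  have hg : Integrable fun y => φ y • g y :=
    (locallyIntegrable_of_eval fun k => (hfg k).2.1).integrable_smul_left_of_hasCompactSupport
      hφ.continuous hc
  ext k
  rw [Pi.neg_apply, eval_integral fun i => hf.eval i, eval_integral fun i => hg.eval i]
  simpa only [Pi.smul_apply, Complex.real_smul, mul_comm] using (hfg k).2.2 φ hφ hc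

-- By the anticommutation relations `(α · D)(α · Φ) = -i div Φ` for curl-free `Φ`.
lemma divergence_smul_eq_sum {Φ : E3 → E3} {y : E3} (hΦ : DifferentiableAt ℝ Φ y)
    (hsymm : (fderiv ℝ Φ y : E3 →ₗ[ℝ] E3).IsSymmetric) (u : Fin 4 → ℂ) :
    divergence Φ y • u = ∑ m, ∑ j, (alpha m * alpha j) *ᵥ
      (fderiv ℝ (fun z => Φ z m) y (EuclideanSpace.single j 1) • u) := by
  have hentry : ∀ m j, fderiv ℝ (fun z => Φ z m) y (EuclideanSpace.single j 1) =
      inner ℝ (EuclideanSpace.single m 1) (fderiv ℝ Φ y (EuclideanSpace.single j 1)) := by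
    intro m j
    have h := ((EuclideanSpace.proj m : E3 →L[ℝ] ℝ).hasFDerivAt.comp y hΦ.hasFDerivAt).fderiv
    rw [EuclideanSpace.inner_single_left]
    simpa [Function.comp_def] using congrArg (fun L => L (EuclideanSpace.single j 1)) h
  have hcontract := sum_smul_alpha_mul_alpha
    (S := fun m j => fderiv ℝ (fun z => Φ z m) y (EuclideanSpace.single j 1)) fun m j => by
      simp only [hentry]
      rw [real_inner_comm]
      exact hsymm _ _
  have htrace : divergence Φ y = ∑ j, fderiv ℝ (fun z => Φ z j) y (EuclideanSpace.single j 1) := by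
    simp only [hentry, divergence]
    simpa using LinearMap.trace_eq_sum_inner (fderiv ℝ Φ y : E3 →ₗ[ℝ] E3)
      (EuclideanSpace.basisFun (Fin 3) ℝ)
  rw [htrace, Finset.sum_smul]
  simpa only [Matrix.sum_mulVec, Matrix.smul_mulVec, Matrix.mulVec_smul, Matrix.one_mulVec] using
    (congrArg (fun M => M *ᵥ u) hcontract).symm

lemma alphaDot_mulVec_sum_alpha (v : E3) (D : Fin 3 → Fin 4 → ℂ) :
    alphaDot v *ᵥ ∑ j, alpha j *ᵥ ((1 / Complex.I) • D j) =
      (-Complex.I) • ∑ m, ∑ j, (alpha m * alpha j) *ᵥ (v m • D j) := by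
  simp only [alphaDot, Matrix.sum_mulVec, Matrix.smul_mulVec, Matrix.mulVec_sum,
    Finset.smul_sum, Matrix.mulVec_smul, ← Matrix.mulVec_mulVec, one_div, Complex.inv_I]
  rw [Finset.sum_comm]
  refine Finset.sum_congr rfl fun m _ => Finset.sum_congr rfl fun j _ => ?_
  rw [Complex.coe_smul, smul_comm]

lemma integral_divergence_smul {f h : E3 → Fin 4 → ℂ} (hfh : HasDiracImage 0 f h)
    {Φ : E3 → E3} (hΦ : ContDiff ℝ ∞ Φ) (hc : HasCompactSupport Φ)
    (hsymm : ∀ y, (fderiv ℝ Φ y : E3 →ₗ[ℝ] E3).IsSymmetric) :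
    ∫ y, divergence Φ y • f y = (-Complex.I) • ∫ y, alphaDot (Φ y) *ᵥ h y := by
  obtain ⟨Df, hDf, hh⟩ := hfh
  have hΦ_coord : ∀ m, ContDiff ℝ ∞ fun y => Φ y m := fun m =>
    (EuclideanSpace.proj m : E3 →L[ℝ] ℝ).contDiff.comp hΦ
  have hc_coord : ∀ m, HasCompactSupport fun y => Φ y m := fun m =>
    hc.comp_left (g := fun v : E3 => v m) rfl
  have hf_int : ∀ m j, Integrable fun y =>
      fderiv ℝ (fun z => Φ z m) y (EuclideanSpace.single j 1) • f y := fun m j =>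
    (locallyIntegrable_of_eval fun k => (hDf j k).1).integrable_smul_left_of_hasCompactSupport
      (((hΦ_coord m).continuous_fderiv (by simp)).clm_apply continuous_const)
      ((hc_coord m).fderiv_apply ℝ _)
  have hDf_int : ∀ m j, Integrable fun y => Φ y m • Df j y := fun m j =>
    (locallyIntegrable_of_eval fun k => (hDf j k).2.1).integrable_smul_left_of_hasCompactSupport
      (hΦ_coord m).continuous (hc_coord m)
  calc ∫ y, divergence Φ y • f y
      = ∑ m, ∑ j, (alpha m * alpha j) *ᵥ
          ∫ y, fderiv ℝ (fun z => Φ z m) y (EuclideanSpace.single j 1) • f y := by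
        simp only [fun y => divergence_smul_eq_sum (hΦ.differentiable (by simp) y) (hsymm y),
          ← fun m j => integral_mulVec (alpha m * alpha j) (hf_int m j)]
        rw [integral_finsetSum _ fun m _ =>
          integrable_finsetSum _ fun j _ => integrable_mulVec _ (hf_int m j)]
        exact Finset.sum_congr rfl fun m _ =>
          integral_finsetSum _ fun j _ => integrable_mulVec _ (hf_int m j)
    _ = -∑ m, ∑ j, (alpha m * alpha j) *ᵥ ∫ y, Φ y m • Df j y := by
        simp only [fun m j => integral_fderiv_smul_eq_neg (hDf j) (hΦ_coord m) (hc_coord m),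
          Matrix.mulVec_neg, Finset.sum_neg_distrib]
    _ = -∫ y, ∑ m, ∑ j, (alpha m * alpha j) *ᵥ (Φ y m • Df j y) := by
        simp only [← fun m j => integral_mulVec (alpha m * alpha j) (hDf_int m j)]
        rw [integral_finsetSum _ fun m _ =>
          integrable_finsetSum _ fun j _ => integrable_mulVec _ (hDf_int m j)]
        exact congrArg Neg.neg (Finset.sum_congr rfl fun m _ =>
          (integral_finsetSum _ fun j _ => integrable_mulVec _ (hDf_int m j)).symm)
    _ = (-Complex.I) • ∫ y, alphaDot (Φ y) *ᵥ h y := by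
        rw [← integral_neg, ← integral_smul]
        refine integral_congr_ae ?_
        filter_upwards [hh] with y hy
        rw [hy, Pi.zero_apply, Matrix.zero_mulVec, add_zero, alphaDot_mulVec_sum_alpha, smul_smul]
        simp

lemma integral_divergence_sub_smul {f h : E3 → Fin 4 → ℂ} (hfh : HasDiracImage 0 f h)
    {Ψ : E3 → E3} (hΨ : ContDiff ℝ ∞ Ψ) (hc : HasCompactSupport Ψ)
    (hsymm : ∀ z, (fderiv ℝ Ψ z : E3 →ₗ[ℝ] E3).IsSymmetric) (x : E3) :
    ∫ y, divergence Ψ (x - y) • f y = Complex.I • ∫ y, alphaDot (Ψ (x - y)) *ᵥ h y := by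
  have hfderiv : ∀ y, fderiv ℝ (fun y => Ψ (x - y)) y = -fderiv ℝ Ψ (x - y) := by
    intro y
    have hchain := (hΨ.differentiable (by simp) (x - y)).hasFDerivAt.comp y
      ((hasFDerivAt_id y).const_sub x)
    simpa [Function.comp_def] using hchain.fderiv
  have hparts := integral_divergence_smul hfh (Φ := fun y => Ψ (x - y))
    (hΨ.comp (contDiff_const.sub contDiff_id)) (hc.comp_homeomorph (Homeomorph.subLeft x))
    fun y => by
      rw [hfderiv]
      exact fun v w => by simpa using hsymm (x - y) v w
  simp only [divergence, hfderiv] at hparts ⊢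
  simpa [integral_neg] using hparts

end IntegrationByParts

section Mollification

lemma setAverage_norm_le {X F : Type*} [MeasurableSpace X] [NormedAddCommGroup F] {ν : Measure X}
    {g : X → F} {p : ℝ≥0∞} (hp : 1 ≤ p) (hg : MemLp g p ν) {s : Set X} (hs : ν s ≠ 0)
    (hs' : ν s ≠ ∞) :
    ⨍ y in s, ‖g y‖ ∂ν ≤ (eLpNorm g p ν).toReal * ν.real s ^ (-p.toReal⁻¹) := by
  have hpos : 0 < ν.real s := ENNReal.toReal_pos hs hs'
  have hholder : ∫ y in s, ‖g y‖ ∂ν ≤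
      (eLpNorm g p ν).toReal * ν.real s ^ (1 - p.toReal⁻¹) := by
    have h := eLpNorm_le_eLpNorm_mul_rpow_measure_univ (μ := ν.restrict s) hp hg.1.restrict
    rw [eLpNorm_one_eq_lintegral_enorm, Measure.restrict_apply_univ, ENNReal.toReal_one,
      div_one, one_div] at h
    have hfin : ν s ^ (1 - p.toReal⁻¹) ≠ ∞ := ENNReal.rpow_ne_top_of_ne_zero hs hs'
    rw [integral_norm_eq_lintegral_enorm hg.1.restrict, Measure.real, ENNReal.toReal_rpow,
      ← ENNReal.toReal_mul]
    exact ENNReal.toReal_mono (ENNReal.mul_ne_top hg.eLpNorm_ne_top hfin)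
      (h.trans (by gcongr; exact Measure.restrict_le_self))
  calc ⨍ y in s, ‖g y‖ ∂ν
      ≤ (ν.real s)⁻¹ * ((eLpNorm g p ν).toReal * ν.real s ^ (1 - p.toReal⁻¹)) := by
        rw [setAverage_eq, smul_eq_mul]
        gcongr
    _ = (eLpNorm g p ν).toReal * ν.real s ^ (-p.toReal⁻¹) := by
        rw [sub_eq_add_neg, Real.rpow_add hpos, Real.rpow_one]
        field_simp

variable {E : Type*} [NormedAddCommGroup E] [NormedSpace ℝ E] {ψ : E → ℝ}

/-- The dilation `z ↦ t⁻ᵈ ψ(z / t)`, `d = dim E`, which preserves the integral of `ψ`. -/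
def dilate (t : ℝ) (ψ : E → ℝ) (z : E) : ℝ := (t ^ finrank ℝ E)⁻¹ * ψ (t⁻¹ • z)

lemma continuous_dilate (hψ : Continuous ψ) (t : ℝ) : Continuous (dilate t ψ) := by
  unfold dilate
  fun_prop

lemma hasCompactSupport_dilate (hc : HasCompactSupport ψ) {t : ℝ} (ht : 0 < t) :
    HasCompactSupport (dilate t ψ) :=
  (hc.comp_smul (inv_ne_zero ht.ne')).mul_left

lemma exists_abs_dilate_le (hψ : Continuous ψ) (hc : HasCompactSupport ψ) :
    ∃ D, 0 ≤ D ∧ ∃ r, 0 < r ∧ ∀ t, 0 < t → ∀ z, |dilate t ψ z| ≤ (t ^ finrank ℝ E)⁻¹ * D ∧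
      (r * t < ‖z‖ → dilate t ψ z = 0) := by
  obtain ⟨D, hD⟩ := hc.exists_bound_of_continuous hψ
  obtain ⟨r, hr, hsupp⟩ := hc.isCompact.isBounded.exists_pos_norm_le
  refine ⟨D, (norm_nonneg _).trans (hD 0), r, hr, fun t ht z => ⟨?_, fun hz => ?_⟩⟩
  · rw [dilate, abs_mul, abs_of_pos (by positivity)]
    gcongr
    exact hD _
  · suffices h : t⁻¹ • z ∉ tsupport ψ by rw [dilate, image_eq_zero_of_notMem_tsupport h, mul_zero]
    intro hmem
    have h := hsupp _ hmem
    rw [norm_smul, norm_inv, Real.norm_of_nonneg ht.le, inv_mul_le_iff₀ ht, mul_comm] at h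
    exact hz.not_ge h

variable [MeasurableSpace E] [BorelSpace E] {μ : Measure E} {F : Type*} [NormedAddCommGroup F]
  [NormedSpace ℝ F] {f : E → F}

lemma integrable_dilate_smul (hψ : Continuous ψ) (hc : HasCompactSupport ψ)
    (hf : LocallyIntegrable f μ) {t : ℝ} (ht : 0 < t) (x : E) :
    Integrable (fun y => dilate t ψ (x - y) • f y) μ :=
  hf.integrable_smul_left_of_hasCompactSupport
    ((continuous_dilate hψ t).comp (continuous_const.sub continuous_id))
    ((hasCompactSupport_dilate hc ht).comp_homeomorph (Homeomorph.subLeft x))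

variable [FiniteDimensional ℝ E] [μ.IsAddHaarMeasure]

variable (μ) in
lemma integral_dilate (ψ : E → ℝ) {t : ℝ} (ht : 0 < t) :
    ∫ z, dilate t ψ z ∂μ = ∫ z, ψ z ∂μ := by
  have ht' : t ^ finrank ℝ E ≠ 0 := by positivity
  simp only [dilate, integral_const_mul, Measure.integral_comp_inv_smul_of_nonneg μ ψ ht.le,
    smul_eq_mul, inv_mul_cancel_left₀ ht']

variable (μ) in
lemma exists_norm_integral_dilate_smul_le (hψ : Continuous ψ) (hc : HasCompactSupport ψ) :
    ∃ K r, 0 ≤ K ∧ 0 < r ∧ ∀ f : E → F, LocallyIntegrable f μ → ∀ x t, 0 < t →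
      ‖∫ y, dilate t ψ (x - y) • f y ∂μ‖ ≤ K * ⨍ y in closedBall x (r * t), ‖f y‖ ∂μ := by
  obtain ⟨D, hD, r, hr, hψt⟩ := exists_abs_dilate_le hψ hc
  refine ⟨D * (r ^ finrank ℝ E * μ.real (ball 0 1)), r, by positivity, hr, fun f hf x t ht => ?_⟩
  have hball : μ.real (closedBall x (r * t)) = r ^ finrank ℝ E * t ^ finrank ℝ E *
      μ.real (ball 0 1) := by
    rw [Measure.addHaar_real_closedBall μ x (by positivity), mul_pow]
  have hunit : μ.real (ball 0 1) ≠ 0 := ENNReal.toReal_ne_zero.2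
    ⟨(measure_ball_pos μ 0 one_pos).ne', measure_ball_lt_top.ne⟩
  calc ‖∫ y, dilate t ψ (x - y) • f y ∂μ‖
      = ‖∫ y in closedBall x (r * t), dilate t ψ (x - y) • f y ∂μ‖ := by
        rw [setIntegral_eq_integral_of_forall_compl_eq_zero fun y hy => ?_]
        rw [(hψt t ht _).2, zero_smul]
        rwa [mem_closedBall, not_le, dist_comm, dist_eq_norm] at hy
    _ ≤ ∫ y in closedBall x (r * t), (t ^ finrank ℝ E)⁻¹ * D * ‖f y‖ ∂μ := by
        refine norm_integral_le_of_norm_le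
          ((hf.integrableOn_isCompact (isCompact_closedBall _ _)).norm.const_mul _)
          (ae_of_all _ fun y => ?_)
        rw [norm_smul]
        gcongr
        exact (hψt t ht _).1
    _ = D * (r ^ finrank ℝ E * μ.real (ball 0 1)) *
          ⨍ y in closedBall x (r * t), ‖f y‖ ∂μ := by
        rw [integral_const_mul, setAverage_eq, hball, smul_eq_mul]
        field_simp

lemma ae_tendsto_integral_dilate_smul [CompleteSpace F] (hψ : Continuous ψ)
    (hc : HasCompactSupport ψ) (hf : LocallyIntegrable f μ) :
    ∀ᵐ x ∂μ, Tendsto (fun t : ℝ => ∫ y, dilate t ψ (x - y) • f y ∂μ) (𝓝[>] 0)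
      (𝓝 ((∫ z, ψ z ∂μ) • f x)) := by
  obtain ⟨K, r, -, hr, hK⟩ := exists_norm_integral_dilate_smul_le (F := F) μ hψ hc
  have hradius : Tendsto (fun t : ℝ => r * t) (𝓝[>] 0) (𝓝[>] 0) := by
    refine tendsto_nhdsWithin_iff.2 ⟨?_, ?_⟩
    · exact ((continuous_const_mul r).tendsto' 0 0 (mul_zero r)).mono_left nhdsWithin_le_nhds
    · filter_upwards [self_mem_nhdsWithin] with t ht using mul_pos hr ht
  filter_upwards [IsUnifLocDoublingMeasure.ae_tendsto_average_norm_sub μ hf 1] with x hx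
  have haverage := (hx (fun _ : ℝ => x) (fun t => r * t) hradius (by
    filter_upwards [self_mem_nhdsWithin] with t (ht : 0 < t)
    rw [one_mul]
    exact mem_closedBall_self (by positivity))).const_mul K
  rw [mul_zero] at haverage
  rw [tendsto_iff_norm_sub_tendsto_zero]
  refine squeeze_zero' (Eventually.of_forall fun _ => norm_nonneg _) ?_ haverage
  filter_upwards [self_mem_nhdsWithin] with t (ht : 0 < t)
  have hconst : LocallyIntegrable (fun _ => f x) μ := locallyIntegrable_const _
  have hcenter : (∫ z, ψ z ∂μ) • f x = ∫ y, dilate t ψ (x - y) • f x ∂μ := by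
    rw [integral_smul_const, integral_sub_left_eq_self (dilate t ψ), integral_dilate μ ψ ht]
  rw [hcenter, ← integral_sub (integrable_dilate_smul hψ hc hf ht x)
    (integrable_dilate_smul hψ hc hconst ht x)]
  simpa only [smul_sub, Pi.sub_apply] using hK _ (hf.sub hconst) x t ht

lemma tendsto_integral_dilate_smul_atTop [Nontrivial E] (hψ : Continuous ψ)
    (hc : HasCompactSupport ψ) {p : ℝ≥0∞} (hp : 1 ≤ p) (hp' : p ≠ ∞) (hf : MemLp f p μ) (x : E) :
    Tendsto (fun R : ℝ => ∫ y, dilate R ψ (x - y) • f y ∂μ) atTop (𝓝 0) := by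
  obtain ⟨K, r, hK0, hr, hK⟩ := exists_norm_integral_dilate_smul_le (F := F) μ hψ hc
  have hvolume : Tendsto (fun R : ℝ => μ.real (closedBall x (r * R))) atTop atTop := by
    have hunit : 0 < μ.real (ball (0 : E) 1) :=
      ENNReal.toReal_pos (measure_ball_pos μ 0 one_pos).ne' measure_ball_lt_top.ne
    refine (((tendsto_pow_atTop (finrank_pos (R := ℝ) (M := E)).ne').comp
      (tendsto_id.const_mul_atTop hr)).atTop_mul_const hunit).congr' ?_
    filter_upwards [eventually_gt_atTop 0] with R hR
    exact (Measure.addHaar_real_closedBall μ x (by positivity)).symm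
  have hp0 : 0 < p.toReal := ENNReal.toReal_pos (one_pos.trans_le hp).ne' hp'
  have hbound := (((tendsto_rpow_neg_atTop (inv_pos.2 hp0)).comp hvolume).const_mul
    (eLpNorm f p μ).toReal).const_mul K
  rw [mul_zero, mul_zero] at hbound
  refine squeeze_zero_norm' ?_ hbound
  filter_upwards [eventually_gt_atTop 0] with R hR
  refine (hK f (hf.locallyIntegrable hp) x R hR).trans ?_
  exact mul_le_mul_of_nonneg_left (setAverage_norm_le hp hf
    (measure_closedBall_pos μ x (by positivity)).ne' measure_closedBall_lt_top.ne) hK0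

end Mollification

section RadialField

open scoped ContDiff

variable {E : Type*} [NormedAddCommGroup E] [InnerProductSpace ℝ E] {p : ℝ → ℝ}

/-- The radial vector field `z ↦ p(|z|²) z`. -/
def radialField (p : ℝ → ℝ) (z : E) : E := p (‖z‖ ^ 2) • z

lemma contDiff_radialField {n : ℕ∞ω} (hp : ContDiff ℝ n p) :
    ContDiff ℝ n (radialField p : E → E) :=
  (hp.comp (contDiff_norm_sq ℝ)).smul contDiff_id

lemma fderiv_radialField (hp : Differentiable ℝ p) (z : E) : fderiv ℝ (radialField p) z =
    p (‖z‖ ^ 2) • ContinuousLinearMap.id ℝ E +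
      (2 * deriv p (‖z‖ ^ 2)) • (innerSL ℝ z).smulRight z := by
  have hnorm : HasFDerivAt (fun z : E => ‖z‖ ^ 2) (2 • innerSL ℝ z) z :=
    (hasStrictFDerivAt_norm_sq z).hasFDerivAt
  have h := ((hp (‖z‖ ^ 2)).hasDerivAt.comp_hasFDerivAt z hnorm).smul (hasFDerivAt_id z)
  refine h.fderiv.trans ?_
  ext v
  simp only [add_apply, smul_apply, ContinuousLinearMap.smulRight_apply,
    ContinuousLinearMap.id_apply, Function.comp_apply, id_eq, innerSL_apply_apply, smul_smul,
    smul_eq_mul, nsmul_eq_mul, Nat.cast_ofNat]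
  ring_nf

lemma isSymmetric_fderiv_radialField (hp : Differentiable ℝ p) (z : E) :
    (fderiv ℝ (radialField p) z : E →ₗ[ℝ] E).IsSymmetric := by
  intro v w
  rw [fderiv_radialField hp]
  simp only [ContinuousLinearMap.coe_coe, add_apply, smul_apply,
    ContinuousLinearMap.smulRight_apply,
    ContinuousLinearMap.id_apply, innerSL_apply_apply, inner_add_left, inner_add_right,
    real_inner_smul_left, real_inner_smul_right, real_inner_comm v z]
  ring

variable [FiniteDimensional ℝ E]

lemma divergence_radialField (hp : Differentiable ℝ p) (z : E) : divergence (radialField p) z =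
    finrank ℝ E * p (‖z‖ ^ 2) + 2 * ‖z‖ ^ 2 * deriv p (‖z‖ ^ 2) := by
  rw [divergence, fderiv_radialField hp]
  simp only [ContinuousLinearMap.toLinearMap_add, ContinuousLinearMap.toLinearMap_smul,
    ContinuousLinearMap.coe_id, ContinuousLinearMap.coe_smulRight,
    ContinuousLinearMap.toLinearMap_innerSL_apply, map_add, map_smul, LinearMap.trace_id,
    LinearMap.trace_smulRight, innerₛₗ_apply_apply, real_inner_self_eq_norm_sq, smul_eq_mul]
  ring

lemma continuous_divergence {Φ : E → E} (hΦ : ContDiff ℝ 1 Φ) : Continuous (divergence Φ) :=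
  ((LinearMap.trace ℝ E).comp (ContinuousLinearMap.coeLM ℝ)).continuous_of_finiteDimensional.comp
    (hΦ.continuous_fderiv one_ne_zero)

lemma hasDerivAt_pow_mul_comp_sq (hp : Differentiable ℝ p) {d : ℕ} (hd : d ≠ 0) (r : ℝ) :
    HasDerivAt (fun r => r ^ d * p (r ^ 2))
      (r ^ (d - 1) * (d * p (r ^ 2) + 2 * r ^ 2 * deriv p (r ^ 2))) r := by
  have h := (hasDerivAt_pow d r).mul ((hp (r ^ 2)).hasDerivAt.comp r (hasDerivAt_pow 2 r))
  refine h.congr_deriv ?_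
  obtain ⟨n, rfl⟩ := Nat.exists_eq_succ_of_ne_zero hd
  simp only [Nat.succ_eq_add_one, add_tsub_cancel_right, Nat.add_one_sub_one, pow_one,
    Function.comp_apply, Nat.cast_ofNat]
  ring

lemma mul_add_mul_deriv_eq_zero (hp : Differentiable ℝ p) {d : ℕ} (hd : d ≠ 0) {a c r : ℝ}
    (ha : 0 ≤ a) (hpa : ∀ r, a ≤ r → r ^ d * p (r ^ 2) = c) (hr : a < r) :
    d * p (r ^ 2) + 2 * r ^ 2 * deriv p (r ^ 2) = 0 := by
  have hconst : HasDerivAt (fun r => r ^ d * p (r ^ 2)) 0 r := by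
    refine (hasDerivAt_const r c).congr_of_eventuallyEq ?_
    filter_upwards [Ioi_mem_nhds hr] with s hs using hpa s hs.le
  exact (mul_eq_zero.1 ((hasDerivAt_pow_mul_comp_sq hp hd r).unique hconst)).resolve_left
    (pow_ne_zero _ (ha.trans_lt hr).ne')

variable [Nontrivial E]

lemma hasCompactSupport_divergence_radialField (hp : Differentiable ℝ p) {a c : ℝ} (ha : 0 ≤ a)
    (hpa : ∀ r, a ≤ r → r ^ finrank ℝ E * p (r ^ 2) = c) :
    HasCompactSupport (divergence (radialField p) : E → ℝ) := by
  refine HasCompactSupport.intro (isCompact_closedBall 0 a) fun z hz => ?_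
  rw [mem_closedBall_zero_iff, not_le] at hz
  rw [divergence_radialField hp, mul_add_mul_deriv_eq_zero hp finrank_pos.ne' ha hpa hz]

variable [MeasurableSpace E] [BorelSpace E] (μ : Measure E) [μ.IsAddHaarMeasure]

lemma integral_divergence_radialField (hp : ContDiff ℝ 1 p) {a c : ℝ} (ha : 0 ≤ a)
    (hpa : ∀ r, a ≤ r → r ^ finrank ℝ E * p (r ^ 2) = c) :
    ∫ z : E, divergence (radialField p) z ∂μ = finrank ℝ E * μ.real (ball 0 1) * c := by
  have hp' : Differentiable ℝ p := hp.differentiable one_ne_zero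
  have hderiv : ∀ r : ℝ, HasDerivAt (fun r => r ^ finrank ℝ E * p (r ^ 2)) _ r :=
    hasDerivAt_pow_mul_comp_sq hp' finrank_pos.ne'
  have hradial : ∫ r in Set.Ioi (0 : ℝ), r ^ (finrank ℝ E - 1) *
      (finrank ℝ E * p (r ^ 2) + 2 * r ^ 2 * deriv p (r ^ 2)) = c := by
    rw [setIntegral_eq_of_subset_of_forall_sdiff_eq_zero measurableSet_Ioi
      Set.Ioc_subset_Ioi_self fun r hr => ?_,
      ← intervalIntegral.integral_of_le ha,
      intervalIntegral.integral_eq_sub_of_hasDerivAt fun r _ => hderiv r, hpa a le_rfl]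
    · simp [finrank_pos.ne']
    · have := hp.continuous
      have := hp.continuous_deriv le_rfl
      exact Continuous.intervalIntegrable (by fun_prop) _ _
    · rw [mul_add_mul_deriv_eq_zero hp' finrank_pos.ne' ha hpa
        (not_le.1 fun h => hr.2 ⟨hr.1, h⟩), mul_zero]
  simp only [divergence_radialField hp']
  rw [integral_fun_norm_addHaar μ fun r =>
    finrank ℝ E * p (r ^ 2) + 2 * r ^ 2 * deriv p (r ^ 2)]
  simp only [smul_eq_mul, nsmul_eq_mul, hradial]
  ring

end RadialField

section NewtonField

open scoped ContDiff

/-- The field `z / |z|³`, which is `-∇(1 / |z|)`. -/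
def newton (z : E3) : E3 := (‖z‖ ^ 3)⁻¹ • z

lemma norm_newton (z : E3) : ‖newton z‖ = (‖z‖ ^ 2)⁻¹ := by
  rcases eq_or_ne z 0 with rfl | hz
  · simp [newton]
  · have := norm_pos_iff.2 hz
    rw [newton, norm_smul, Real.norm_of_nonneg (by positivity)]
    field_simp

lemma enorm_newton_le (z : E3) : ‖newton z‖ₑ ≤ riesz 2 z := by
  rcases eq_or_ne z 0 with rfl | hz
  · simp [newton]
  · rw [riesz_eq_ofReal 2 hz, ← ofReal_norm, norm_newton, Real.rpow_neg (norm_nonneg z)]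
    norm_cast

lemma measurable_newton : Measurable newton := by
  unfold newton
  fun_prop

lemma newton_smul {c : ℝ} (hc : 0 ≤ c) (z : E3) : newton (c • z) = (c ^ 2)⁻¹ • newton z := by
  rcases hc.eq_or_lt with rfl | hc
  · simp [newton]
  · rw [newton, newton, norm_smul, Real.norm_of_nonneg hc.le, smul_smul, smul_smul]
    congr 1
    field_simp

/-- The Newton field smoothly truncated to `|z| ≥ t`. -/
def truncatedNewton (t : ℝ) (z : E3) : E3 :=
  Real.smoothTransition (‖t⁻¹ • z‖ ^ 2 - 1) • newton z

lemma truncatedNewton_of_norm_le {t : ℝ} (ht : 0 < t) {z : E3} (hz : ‖z‖ ≤ t) :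
    truncatedNewton t z = 0 := by
  rw [truncatedNewton, Real.smoothTransition.zero_of_nonpos, zero_smul]
  rw [norm_smul, norm_inv, Real.norm_of_nonneg ht.le, inv_mul_eq_div, sub_nonpos]
  exact pow_le_one₀ (by positivity) ((div_le_one ht).2 hz)

lemma truncatedNewton_of_le_norm {t : ℝ} (ht : 0 < t) {z : E3} (hz : 2 * t ≤ ‖z‖) :
    truncatedNewton t z = newton z := by
  have hz' : 2 ≤ ‖t⁻¹ • z‖ := by
    rwa [norm_smul, norm_inv, Real.norm_of_nonneg ht.le, inv_mul_eq_div, le_div_iff₀ ht]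
  rw [truncatedNewton, Real.smoothTransition.one_of_one_le (by nlinarith), one_smul]

lemma enorm_truncatedNewton_sub_le (s t : ℝ) (z : E3) :
    ‖truncatedNewton s z - truncatedNewton t z‖ₑ ≤ riesz 2 z := by
  refine le_trans ?_ (enorm_newton_le z)
  rw [enorm_le_iff_norm_le, truncatedNewton, truncatedNewton, ← sub_smul, norm_smul]
  refine mul_le_of_le_one_left (norm_nonneg _) (abs_sub_le_of_nonneg_of_le ?_ ?_ ?_ ?_)
  exacts [Real.smoothTransition.nonneg _, Real.smoothTransition.le_one _,
    Real.smoothTransition.nonneg _, Real.smoothTransition.le_one _]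

lemma tendsto_truncatedNewton (z : E3) :
    Tendsto (fun t => truncatedNewton t z - truncatedNewton t⁻¹ z) (𝓝[>] 0) (𝓝 (newton z)) := by
  refine tendsto_const_nhds.congr' ?_
  rcases eq_or_ne z 0 with rfl | hz
  · simp [truncatedNewton, newton]
  · have hpos := norm_pos_iff.2 hz
    filter_upwards [Ioo_mem_nhdsGT (by positivity : 0 < min (‖z‖ / 2) ‖z‖⁻¹)] with t ⟨ht, htz⟩
    obtain ⟨hsmall, hlarge⟩ := lt_min_iff.1 htz
    rw [truncatedNewton_of_le_norm ht (by linarith),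
      truncatedNewton_of_norm_le (inv_pos.2 ht) ((le_inv_comm₀ hpos ht).2 hlarge.le), sub_zero]

/-- The profile for which `radialField` is the Newton field truncated at unit scale. -/
def newtonProfile (s : ℝ) : ℝ := Real.smoothTransition (s - 1) * s ^ (-(3 / 2) : ℝ)

lemma contDiff_newtonProfile {n : ℕ∞} : ContDiff ℝ n newtonProfile := by
  refine contDiff_iff_contDiffAt.2 fun s => ?_
  rcases lt_or_ge s 1 with hs | hs
  · refine contDiffAt_const (c := 0) |>.congr_of_eventuallyEq ?_
    filter_upwards [Iio_mem_nhds hs] with r (hr : r < 1)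
    rw [newtonProfile, Real.smoothTransition.zero_of_nonpos (by linarith), zero_mul]
  · exact (Real.smoothTransition.contDiffAt.comp s (contDiffAt_id.sub contDiffAt_const)).mul
      (Real.contDiffAt_rpow_const_of_ne (by linarith))

lemma sq_rpow_neg_three_halves {r : ℝ} (hr : 0 ≤ r) : (r ^ 2) ^ (-(3 / 2) : ℝ) = (r ^ 3)⁻¹ := by
  rw [← Real.rpow_natCast r 2, ← Real.rpow_mul hr, ← Real.rpow_natCast r 3, ← Real.rpow_neg hr]
  norm_num

lemma truncatedNewton_eq_radialField {t : ℝ} (ht : 0 < t) (z : E3) :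
    truncatedNewton t z = (t ^ 2)⁻¹ • radialField newtonProfile (t⁻¹ • z) := by
  have hnewton : newton z = (t ^ 2)⁻¹ • newton (t⁻¹ • z) := by
    rw [newton_smul (inv_nonneg.2 ht.le), inv_pow, inv_inv, inv_smul_smul₀ (by positivity)]
  rw [truncatedNewton, hnewton, newton, radialField, newtonProfile,
    sq_rpow_neg_three_halves (norm_nonneg _), smul_comm, mul_smul]

lemma contDiff_truncatedNewton {t : ℝ} (ht : 0 < t) : ContDiff ℝ ∞ (truncatedNewton t) := by
  simp only [funext (truncatedNewton_eq_radialField ht)]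
  exact ((contDiff_radialField contDiff_newtonProfile).comp (contDiff_const_smul _)).const_smul _

lemma fderiv_truncatedNewton {t : ℝ} (ht : 0 < t) (z : E3) : fderiv ℝ (truncatedNewton t) z =
    (t ^ 3)⁻¹ • fderiv ℝ (radialField newtonProfile) (t⁻¹ • z) := by
  have h : truncatedNewton t =
      (t ^ 2)⁻¹ • fun z => radialField newtonProfile (t⁻¹ • z) :=
    funext (truncatedNewton_eq_radialField ht)
  rw [h, fderiv_const_smul_field, Pi.smul_apply, fderiv_comp_smul, smul_smul]
  congr 1
  field_simp

/-- The divergence of the Newton field truncated at unit scale: a mollifier of mass `4π`. -/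
def newtonMollifier : E3 → ℝ := divergence (radialField newtonProfile)

lemma differentiable_newtonProfile : Differentiable ℝ newtonProfile :=
  (contDiff_newtonProfile (n := 1)).differentiable one_ne_zero

lemma divergence_truncatedNewton {t : ℝ} (ht : 0 < t) :
    divergence (truncatedNewton t) = dilate t newtonMollifier := by
  ext z
  simp [divergence, dilate, newtonMollifier, fderiv_truncatedNewton ht]

lemma pow_three_mul_newtonProfile_sq {r : ℝ} (hr : 2 ≤ r) : r ^ 3 * newtonProfile (r ^ 2) = 1 := by
  rw [newtonProfile, Real.smoothTransition.one_of_one_le (by nlinarith), one_mul,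
    sq_rpow_neg_three_halves (by linarith), mul_inv_cancel₀ (by positivity)]

lemma integral_newtonMollifier : ∫ z, newtonMollifier z = 4 * Real.pi := by
  rw [newtonMollifier, integral_divergence_radialField volume (a := 2) (c := 1)
    (contDiff_newtonProfile (n := 1)) two_pos.le fun r hr => by
      simpa using pow_three_mul_newtonProfile_sq hr]
  rw [Measure.real, EuclideanSpace.volume_ball_fin_three, finrank_euclideanSpace_fin,
    ENNReal.toReal_mul, ENNReal.toReal_ofReal (by positivity)]
  simp only [ENNReal.ofReal_one, one_pow, ENNReal.toReal_one, Nat.cast_ofNat]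
  ring

lemma continuous_newtonMollifier : Continuous newtonMollifier :=
  continuous_divergence (contDiff_radialField (contDiff_newtonProfile (n := 1)))

lemma hasCompactSupport_newtonMollifier : HasCompactSupport newtonMollifier :=
  hasCompactSupport_divergence_radialField differentiable_newtonProfile (a := 2) (c := 1)
    two_pos.le fun r hr => by simpa using pow_three_mul_newtonProfile_sq hr

end NewtonField

section Representation

variable {f h : E3 → Fin 4 → ℂ}

lemma HasDiracImage.aestronglyMeasurable (hfh : HasDiracImage 0 f h) :
    AEStronglyMeasurable h volume := by
  obtain ⟨Df, hDf, hh⟩ := hfh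
  have hDf_meas : ∀ j, AEStronglyMeasurable (Df j) volume := fun j =>
    (locallyIntegrable_of_eval fun k => (hDf j k).2.1).aestronglyMeasurable
  refine AEStronglyMeasurable.congr ?_ (EventuallyEq.symm hh)
  simp only [Pi.zero_apply, Matrix.zero_mulVec, add_zero]
  fun_prop

lemma HasDiracImage.neg_mulVec {Q : E3 → Matrix (Fin 4) (Fin 4) ℂ} (hf : HasDiracImage Q f 0) :
    HasDiracImage 0 f fun x => -(Q x *ᵥ f x) := by
  obtain ⟨Df, hDf, hker⟩ := hf
  refine ⟨Df, hDf, ?_⟩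
  filter_upwards [hker] with x hx
  rw [Pi.zero_apply, Matrix.zero_mulVec, add_zero]
  exact (eq_neg_of_add_eq_zero_left hx.symm).symm

lemma isSymmetric_fderiv_truncatedNewton {t : ℝ} (ht : 0 < t) (z : E3) :
    (fderiv ℝ (truncatedNewton t) z : E3 →ₗ[ℝ] E3).IsSymmetric := by
  rw [fderiv_truncatedNewton ht]
  exact (isSymmetric_fderiv_radialField differentiable_newtonProfile _).smul (by simp)

lemma integral_newtonMollifier_smul (hfh : HasDiracImage 0 f h) {t R : ℝ} (ht : 0 < t)
    (hR : 0 < R) (x : E3) :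
    ∫ y, (dilate t newtonMollifier (x - y) - dilate R newtonMollifier (x - y)) • f y =
      Complex.I • ∫ y, alphaDot (truncatedNewton t (x - y) - truncatedNewton R (x - y)) *ᵥ h y := by
  have hfderiv : ∀ z, fderiv ℝ (truncatedNewton t - truncatedNewton R) z =
      fderiv ℝ (truncatedNewton t) z - fderiv ℝ (truncatedNewton R) z := fun z =>
    fderiv_sub ((contDiff_truncatedNewton ht).differentiable (by simp) z)
      ((contDiff_truncatedNewton hR).differentiable (by simp) z)
  have hcompact : HasCompactSupport (truncatedNewton t - truncatedNewton R) := by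
    refine HasCompactSupport.intro (isCompact_closedBall 0 (2 * t + 2 * R)) fun z hz => ?_
    rw [mem_closedBall_zero_iff, not_le] at hz
    rw [Pi.sub_apply, truncatedNewton_of_le_norm ht (by linarith),
      truncatedNewton_of_le_norm hR (by linarith), sub_self]
  have hparts := integral_divergence_sub_smul hfh
    (Ψ := truncatedNewton t - truncatedNewton R)
    ((contDiff_truncatedNewton ht).sub (contDiff_truncatedNewton hR)) hcompact (fun z => by
      rw [hfderiv]
      exact (isSymmetric_fderiv_truncatedNewton ht z).sub
        (isSymmetric_fderiv_truncatedNewton hR z)) x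
  have hdiv : divergence (truncatedNewton t - truncatedNewton R) =
      dilate t newtonMollifier - dilate R newtonMollifier := by
    rw [← divergence_truncatedNewton ht, ← divergence_truncatedNewton hR]
    ext z
    simp [divergence, hfderiv]
  simpa only [hdiv, Pi.sub_apply] using hparts

lemma ae_tendsto_integral_truncatedNewton (hfh : HasDiracImage 0 f h) {p : ℝ≥0∞} (hp : 1 ≤ p)
    (hp' : p ≠ ∞) (hf : MemLp f p) :
    ∀ᵐ x, Tendsto (fun t : ℝ => ∫ y,
      alphaDot (truncatedNewton t (x - y) - truncatedNewton t⁻¹ (x - y)) *ᵥ h y) (𝓝[>] 0)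
      (𝓝 ((-Complex.I * (4 * Real.pi)) • f x)) := by
  have hf_loc := hf.locallyIntegrable hp
  have hint := fun t (ht : 0 < t) => integrable_dilate_smul continuous_newtonMollifier
    hasCompactSupport_newtonMollifier hf_loc (t := t) ht
  filter_upwards [ae_tendsto_integral_dilate_smul continuous_newtonMollifier
    hasCompactSupport_newtonMollifier hf_loc] with x hsmall
  have hlarge := (tendsto_integral_dilate_smul_atTop continuous_newtonMollifier
    hasCompactSupport_newtonMollifier hp hp' hf x).comp tendsto_inv_nhdsGT_zero
  have hlim := (hsmall.sub hlarge).const_smul (-Complex.I)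
  have hvalue : -Complex.I • ((∫ z, newtonMollifier z) • f x - 0) =
      (-Complex.I * (4 * Real.pi)) • f x := by
    rw [integral_newtonMollifier, sub_zero, ← Complex.coe_smul, smul_smul]
    push_cast
    rfl
  rw [hvalue] at hlim
  refine hlim.congr' ?_
  filter_upwards [self_mem_nhdsWithin] with t (ht : 0 < t)
  have ht' : 0 < t⁻¹ := inv_pos.2 ht
  rw [Function.comp_apply, ← integral_sub (hint t ht x) (hint t⁻¹ ht' x)]
  simp only [← sub_smul, integral_newtonMollifier_smul hfh ht ht', smul_smul, neg_mul,
    Complex.I_mul_I, neg_neg, one_smul]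

lemma enorm_alphaDot_truncatedNewton_le (s t : ℝ) (z : E3) (u : Fin 4 → ℂ) :
    ‖alphaDot (truncatedNewton s z - truncatedNewton t z) *ᵥ u‖ₑ ≤ 12 * (riesz 2 z * ‖u‖ₑ) := by
  refine (enorm_alphaDot_mulVec_le _ _).trans ?_
  gcongr
  exact enorm_truncatedNewton_sub_le s t z

lemma ae_enorm_le_lintegral_riesz (hfh : HasDiracImage 0 f h) {p : ℝ≥0∞} (hp : 1 ≤ p)
    (hp' : p ≠ ∞) (hf : MemLp f p) :
    ∀ᵐ x, ‖f x‖ₑ ≤ 12 * ∫⁻ y, riesz 2 (x - y) * ‖h y‖ₑ := by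
  filter_upwards [ae_tendsto_integral_truncatedNewton hfh hp hp' hf] with x hx
  have hconst : ‖f x‖ₑ ≤ ‖(-Complex.I * (4 * Real.pi)) • f x‖ₑ := by
    rw [enorm_le_iff_norm_le, norm_smul]
    have hnorm : ‖-Complex.I * (4 * Real.pi)‖ = 4 * Real.pi := by
      simp [abs_of_pos Real.pi_pos]
    exact le_mul_of_one_le_left (norm_nonneg _) (by rw [hnorm]; linarith [Real.pi_gt_three])
  refine hconst.trans (le_of_tendsto hx.enorm (Eventually.of_forall fun t => ?_))
  refine (enorm_integral_le_lintegral_enorm _).trans ?_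
  rw [← lintegral_const_mul' _ _ (by finiteness)]
  exact lintegral_mono fun y => enorm_alphaDot_truncatedNewton_le _ _ _ _

/-- The solution `(i/4π) ∫ α · (x - y) / |x - y|³ h(y) dy` of `(α · D) f = h`. -/
def diracPotential (h : E3 → Fin 4 → ℂ) (x : E3) : Fin 4 → ℂ :=
  (Complex.I / (4 * Real.pi)) • ∫ y, alphaDot (newton (x - y)) *ᵥ h y

lemma tendsto_integral_truncatedNewton (hh : AEStronglyMeasurable h volume) {x : E3}
    (hx : ∫⁻ y, riesz 2 (x - y) * ‖h y‖ₑ ≠ ∞) :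
    Tendsto (fun t : ℝ => ∫ y,
      alphaDot (truncatedNewton t (x - y) - truncatedNewton t⁻¹ (x - y)) *ᵥ h y) (𝓝[>] 0)
      (𝓝 (∫ y, alphaDot (newton (x - y)) *ᵥ h y)) := by
  have hbound_meas : AEMeasurable (fun y => 12 * (riesz 2 (x - y) * ‖h y‖ₑ)) := by fun_prop
  have hbound_fin : ∫⁻ y, 12 * (riesz 2 (x - y) * ‖h y‖ₑ) ≠ ∞ := by
    rw [lintegral_const_mul' _ _ (by finiteness)]
    finiteness
  have hbound_int := integrable_toReal_of_lintegral_ne_top hbound_meas hbound_fin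
  refine tendsto_integral_filter_of_dominated_convergence _ ?_ ?_ hbound_int
    (ae_of_all _ fun y => ?_)
  · filter_upwards [self_mem_nhdsWithin] with t (ht : 0 < t)
    have hcont := (contDiff_truncatedNewton ht).continuous.sub
      (contDiff_truncatedNewton (inv_pos.2 ht)).continuous
    exact aestronglyMeasurable_alphaDot_mulVec
      (hcont.comp (continuous_sub_left x)).aestronglyMeasurable hh
  · refine Eventually.of_forall fun t => ?_
    filter_upwards [ae_lt_top' hbound_meas hbound_fin] with y hy
    rw [← toReal_enorm]
    exact ENNReal.toReal_mono hy.ne (enorm_alphaDot_truncatedNewton_le _ _ _ _)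
  · have hcont : Continuous fun v : E3 => alphaDot v *ᵥ h y := by
      unfold alphaDot
      fun_prop
    exact (hcont.tendsto _).comp (tendsto_truncatedNewton (x - y))

lemma ae_eq_diracPotential (hfh : HasDiracImage 0 f h) {p : ℝ≥0∞} (hp : 1 ≤ p) (hp' : p ≠ ∞)
    (hf : MemLp f p) (hfin : ∀ᵐ x, ∫⁻ y, riesz 2 (x - y) * ‖h y‖ₑ ≠ ∞) :
    f =ᵐ[volume] diracPotential h := by
  filter_upwards [ae_tendsto_integral_truncatedNewton hfh hp hp' hf, hfin] with x hlim hx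
  rw [diracPotential, ← tendsto_nhds_unique hlim
    (tendsto_integral_truncatedNewton hfh.aestronglyMeasurable hx), smul_smul]
  have hpi : (Real.pi : ℂ) ≠ 0 := Complex.ofReal_ne_zero.2 Real.pi_ne_zero
  have hone : Complex.I / (4 * Real.pi) * (-Complex.I * (4 * Real.pi)) = 1 := by
    field_simp
    rw [Complex.I_sq, neg_neg]
  rw [hone, one_smul]

end Representation

section KernelDifferences

lemma norm_newton_sub_le {v w : E3} (hv : v ≠ 0) (hw : w ≠ 0) :
    ‖newton v - newton w‖ ≤
      ‖v - w‖ * (‖v‖ ^ (-2 : ℝ) * ‖w‖ ^ (-1 : ℝ) + ‖v‖ ^ (-1 : ℝ) * ‖w‖ ^ (-2 : ℝ)) := by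
  have hv' := norm_pos_iff.2 hv
  have hw' := norm_pos_iff.2 hw
  have hsplit : newton v - newton w =
      ‖v‖⁻¹ • ((1 / ‖v‖) ^ 2 • v - (1 / ‖w‖) ^ 2 • w) + (‖v‖⁻¹ - ‖w‖⁻¹) • (1 / ‖w‖) ^ 2 • w := by
    simp only [newton]
    module
  have hinversion : ‖(1 / ‖v‖) ^ 2 • v - (1 / ‖w‖) ^ 2 • w‖ = 1 / (‖v‖ * ‖w‖) * ‖v - w‖ := by
    simpa only [dist_eq_norm, one_pow] using dist_div_norm_sq_smul hv hw 1
  have hinv : |‖v‖⁻¹ - ‖w‖⁻¹| ≤ ‖v - w‖ * (‖v‖ * ‖w‖)⁻¹ := by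
    rw [inv_sub_inv hv'.ne' hw'.ne', abs_div, abs_of_pos (mul_pos hv' hw'), ← norm_sub_rev w v,
      div_eq_mul_inv]
    gcongr
    exact abs_norm_sub_norm_le w v
  rw [hsplit]
  refine (norm_add_le _ _).trans ?_
  rw [norm_smul, hinversion, norm_smul, norm_smul, Real.norm_eq_abs (_ - _)]
  refine (add_le_add_right (mul_le_mul_of_nonneg_right hinv (by positivity)) _).trans_eq ?_
  have htwo : ∀ r : ℝ, 0 < r → r ^ (-2 : ℝ) = (r ^ 2)⁻¹ := fun r hr => by
    rw [Real.rpow_neg hr.le, Real.rpow_two]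
  rw [htwo _ hv', htwo _ hw', Real.rpow_neg_one, Real.rpow_neg_one]
  simp only [norm_inv, norm_pow, norm_div, norm_norm, norm_one]
  field_simp

lemma enorm_newton_sub_le {v w : E3} (hv : v ≠ 0) (hw : w ≠ 0) :
    ‖newton v - newton w‖ₑ ≤ ‖v - w‖ₑ * (riesz 2 v * riesz 1 w + riesz 1 v * riesz 2 w) := by
  simp only [riesz_eq_ofReal _ hv, riesz_eq_ofReal _ hw]
  rw [← ofReal_norm, ← ofReal_norm, ← ENNReal.ofReal_mul (by positivity),
    ← ENNReal.ofReal_mul (by positivity), ← ENNReal.ofReal_add (by positivity) (by positivity),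
    ← ENNReal.ofReal_mul (by positivity)]
  exact ENNReal.ofReal_le_ofReal (norm_newton_sub_le hv hw)

-- The geometric mean of the trivial bound and the Lipschitz bound.
lemma enorm_newton_sub_le_rpow_of_norm_le {v w : E3} (hv : v ≠ 0) (hw : w ≠ 0)
    (h : ‖v‖ ≤ ‖w‖) :
    ‖newton v - newton w‖ₑ ≤ 2 * (‖v - w‖ₑ ^ (1 / 2 : ℝ) * riesz (5 / 2) v) := by
  have hsize : ‖newton v - newton w‖ₑ ≤ 2 * riesz 2 v := by
    rw [two_mul]
    refine (enorm_sub_le).trans (add_le_add (enorm_newton_le v) ((enorm_newton_le w).trans ?_))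
    exact riesz_le_riesz_of_norm_le (by norm_num) h
  have hlip : ‖newton v - newton w‖ₑ ≤ 2 * (‖v - w‖ₑ * riesz 3 v) := by
    calc ‖newton v - newton w‖ₑ
        ≤ ‖v - w‖ₑ * (riesz 2 v * riesz 1 w + riesz 1 v * riesz 2 w) := enorm_newton_sub_le hv hw
      _ ≤ ‖v - w‖ₑ * (riesz 2 v * riesz 1 v + riesz 1 v * riesz 2 v) := by
          gcongr
          · exact riesz_le_riesz_of_norm_le (by norm_num) h
          · exact riesz_le_riesz_of_norm_le (by norm_num) h
      _ = 2 * (‖v - w‖ₑ * riesz 3 v) := by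
          rw [riesz_mul_riesz _ _ hv, riesz_mul_riesz _ _ hv]
          norm_num
          ring
  have hhalf : (0 : ℝ) ≤ 1 / 2 := by norm_num
  calc ‖newton v - newton w‖ₑ
      = ‖newton v - newton w‖ₑ ^ (1 / 2 : ℝ) * ‖newton v - newton w‖ₑ ^ (1 / 2 : ℝ) := by
        rw [← ENNReal.rpow_add_of_nonneg _ _ hhalf hhalf]
        norm_num
    _ ≤ (2 * riesz 2 v) ^ (1 / 2 : ℝ) * (2 * (‖v - w‖ₑ * riesz 3 v)) ^ (1 / 2 : ℝ) := by gcongr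
    _ = 2 ^ (1 / 2 + 1 / 2 : ℝ) * (‖v - w‖ₑ ^ (1 / 2 : ℝ) * (riesz 1 v * riesz (3 / 2) v)) := by
        rw [ENNReal.rpow_add_of_nonneg _ _ hhalf hhalf]
        simp only [riesz, ENNReal.mul_rpow_of_nonneg _ _ hhalf, ← ENNReal.rpow_mul]
        norm_num
        ring
    _ = 2 * (‖v - w‖ₑ ^ (1 / 2 : ℝ) * riesz (5 / 2) v) := by
        rw [riesz_mul_riesz _ _ hv]
        norm_num

lemma enorm_newton_sub_le_rpow {v w : E3} (hv : v ≠ 0) (hw : w ≠ 0) :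
    ‖newton v - newton w‖ₑ ≤
      2 * (‖v - w‖ₑ ^ (1 / 2 : ℝ) * (riesz (5 / 2) v + riesz (5 / 2) w)) := by
  rcases le_total ‖v‖ ‖w‖ with h | h
  · refine (enorm_newton_sub_le_rpow_of_norm_le hv hw h).trans ?_
    gcongr
    exact le_self_add
  · rw [enorm_sub_rev, enorm_sub_rev v w]
    refine (enorm_newton_sub_le_rpow_of_norm_le hw hv h).trans ?_
    gcongr
    exact le_add_self

end KernelDifferences

section Potential

variable {h : E3 → Fin 4 → ℂ} {b : ℝ} {B : ℝ≥0∞}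

lemma integrable_alphaDot_newton_mulVec (hh : AEStronglyMeasurable h volume) {x : E3}
    (hx : ∫⁻ y, riesz 2 (x - y) * ‖h y‖ₑ ≠ ∞) :
    Integrable fun y => alphaDot (newton (x - y)) *ᵥ h y := by
  have hmeas : Measurable fun y => newton (x - y) :=
    measurable_newton.comp (measurable_const.sub measurable_id)
  refine ⟨aestronglyMeasurable_alphaDot_mulVec hmeas.aestronglyMeasurable hh, ?_⟩
  calc ∫⁻ y, ‖alphaDot (newton (x - y)) *ᵥ h y‖ₑ
      ≤ ∫⁻ y, 12 * (riesz 2 (x - y) * ‖h y‖ₑ) := by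
        refine lintegral_mono fun y => (enorm_alphaDot_mulVec_le _ _).trans ?_
        gcongr
        exact enorm_newton_le _
    _ = 12 * ∫⁻ y, riesz 2 (x - y) * ‖h y‖ₑ := lintegral_const_mul' _ _ (by finiteness)
    _ < ∞ := by finiteness

lemma enorm_integral_alphaDot_sub_le {Φ Ψ : E3 → E3}
    (hΦ : Integrable fun y => alphaDot (Φ y) *ᵥ h y)
    (hΨ : Integrable fun y => alphaDot (Ψ y) *ᵥ h y) :
    ‖(∫ y, alphaDot (Φ y) *ᵥ h y) - ∫ y, alphaDot (Ψ y) *ᵥ h y‖ₑ ≤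
      12 * ∫⁻ y, ‖Φ y - Ψ y‖ₑ * ‖h y‖ₑ := by
  rw [← integral_sub hΦ hΨ, ← lintegral_const_mul' _ _ (by finiteness)]
  refine (enorm_integral_le_lintegral_enorm _).trans (lintegral_mono fun y => ?_)
  rw [← Matrix.sub_mulVec, ← alphaDot_sub]
  exact enorm_alphaDot_mulVec_le _ _

lemma integrable_of_enorm_le_decayWeight (hh : AEStronglyMeasurable h volume) (hb : 3 < b)
    (hB : B ≠ ∞) (hbound : ∀ᵐ y, ‖h y‖ₑ ≤ B * decayWeight b y) : Integrable h := by
  refine ⟨hh, (lintegral_mono_ae hbound).trans_lt ?_⟩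
  rw [lintegral_const_mul' _ _ hB]
  exact (ENNReal.mul_ne_top hB (lintegral_decayWeight_ne_top volume (by simpa using hb))).lt_top

lemma exists_lintegral_riesz_mul_enorm_le {p : ℝ} (hp : 0 ≤ p) (hp3 : p < 3) (hb : 3 < b)
    (hB : B ≠ ∞) (hbound : ∀ᵐ y, ‖h y‖ₑ ≤ B * decayWeight b y) :
    ∃ K : ℝ≥0∞, K ≠ ∞ ∧ ∀ x : E3, ∫⁻ y, riesz p (x - y) * ‖h y‖ₑ ≤ K := by
  obtain ⟨K, hK, hle⟩ := exists_lintegral_riesz_mul_decayWeight_le (volume : Measure E3)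
    (p := p) (q := b) hp (by simpa using hp3) (by linarith) (by simp; linarith)
  refine ⟨B * K, by finiteness, fun x => ?_⟩
  calc ∫⁻ y, riesz p (x - y) * ‖h y‖ₑ
      ≤ ∫⁻ y, B * (riesz p (x - y) * decayWeight b y) := by
        refine lintegral_mono_ae (hbound.mono fun y hy => ?_)
        rw [mul_left_comm]
        gcongr
    _ = B * ∫⁻ y, riesz p (x - y) * decayWeight b y := lintegral_const_mul' _ _ hB
    _ ≤ B * K := by gcongr; exact hle x

lemma exists_holderWith_diracPotential (hh : AEStronglyMeasurable h volume) (hb : 3 < b)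
    (hB : B ≠ ∞) (hbound : ∀ᵐ y, ‖h y‖ₑ ≤ B * decayWeight b y) :
    ∃ K, HolderWith K (1 / 2) (diracPotential h) := by
  obtain ⟨K₂, hK₂, hle₂⟩ :=
    exists_lintegral_riesz_mul_enorm_le (p := 2) (by norm_num) (by norm_num) hb hB hbound
  obtain ⟨K, hK, hle⟩ :=
    exists_lintegral_riesz_mul_enorm_le (p := 5 / 2) (by norm_num) (by norm_num) hb hB hbound
  have hint := fun x => integrable_alphaDot_newton_mulVec hh (ne_top_of_le_ne_top hK₂ (hle₂ x))
  set c : ℂ := Complex.I / (4 * Real.pi)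
  have hL : ‖c‖ₑ * (12 * (2 * (K + K))) ≠ ∞ := by finiteness
  refine ⟨(‖c‖ₑ * (12 * (2 * (K + K)))).toNNReal, fun x x' => ?_⟩
  rw [ENNReal.coe_toNNReal hL, edist_eq_enorm_sub, edist_eq_enorm_sub, diracPotential,
    diracPotential, ← smul_sub, enorm_smul, mul_assoc]
  refine mul_le_mul_right ?_ _
  calc _ ≤ 12 * ∫⁻ y, ‖newton (x - y) - newton (x' - y)‖ₑ * ‖h y‖ₑ :=
        enorm_integral_alphaDot_sub_le (hint x) (hint x')
    _ ≤ 12 * ∫⁻ y, 2 * ‖x - x'‖ₑ ^ (1 / 2 : ℝ) *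
          (riesz (5 / 2) (x - y) * ‖h y‖ₑ + riesz (5 / 2) (x' - y) * ‖h y‖ₑ) := by
        refine mul_le_mul_right (lintegral_mono_ae ?_) _
        filter_upwards [ae_sub_ne_zero volume x, ae_sub_ne_zero volume x'] with y hy hy'
        refine (mul_le_mul_left (enorm_newton_sub_le_rpow hy hy') _).trans_eq ?_
        rw [sub_sub_sub_cancel_right]
        ring
    _ = 12 * (2 * ‖x - x'‖ₑ ^ (1 / 2 : ℝ) * ((∫⁻ y, riesz (5 / 2) (x - y) * ‖h y‖ₑ) +
          ∫⁻ y, riesz (5 / 2) (x' - y) * ‖h y‖ₑ)) := by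
        rw [lintegral_const_mul' _ _ (by finiteness), lintegral_add_left' (by fun_prop)]
    _ ≤ 12 * (2 * ‖x - x'‖ₑ ^ (1 / 2 : ℝ) * (K + K)) := by
        gcongr
        · exact hle x
        · exact hle x'
    _ = 12 * (2 * (K + K)) * ‖x - x'‖ₑ ^ (1 / 2 : ℝ) := by ring
    _ = _ := by norm_num

lemma lintegral_enorm_newton_sub_mul_le {x : E3} (hx : x ≠ 0) (hB : B ≠ ∞)
    (hbound : ∀ᵐ y, ‖h y‖ₑ ≤ B * riesz b y) :
    ∫⁻ y, ‖newton (x - y) - newton x‖ₑ * ‖h y‖ₑ ≤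
      B * (riesz 1 x * (∫⁻ y, riesz 2 (x - y) * riesz (b - 1) y) +
        riesz 2 x * ∫⁻ y, riesz 1 (x - y) * riesz (b - 1) y) := by
  have hpoint : ∀ᵐ y, ‖newton (x - y) - newton x‖ₑ * ‖h y‖ₑ ≤
      B * (riesz 1 x * (riesz 2 (x - y) * riesz (b - 1) y) +
        riesz 2 x * (riesz 1 (x - y) * riesz (b - 1) y)) := by
    filter_upwards [hbound, ae_sub_ne_zero volume x, ae_ne_zero volume] with y hy hxy hy0
    have hmul : ‖y‖ₑ * riesz b y = riesz (b - 1) y := by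
      have hnorm : ‖y‖ₑ = riesz (-1) y := by simp [riesz]
      rw [hnorm, riesz_mul_riesz _ _ hy0, neg_add_eq_sub]
    calc ‖newton (x - y) - newton x‖ₑ * ‖h y‖ₑ
        ≤ ‖x - y - x‖ₑ * (riesz 2 (x - y) * riesz 1 x + riesz 1 (x - y) * riesz 2 x) *
            (B * riesz b y) := by
          gcongr
          exact enorm_newton_sub_le hxy hx
      _ = B * ((riesz 2 (x - y) * riesz 1 x + riesz 1 (x - y) * riesz 2 x) *
            (‖y‖ₑ * riesz b y)) := by
          rw [sub_sub_cancel_left, enorm_neg]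
          ring
      _ = _ := by
          rw [hmul]
          ring
  refine (lintegral_mono_ae hpoint).trans_eq ?_
  rw [lintegral_const_mul' _ _ hB, lintegral_add_left (by fun_prop),
    lintegral_const_mul' _ _ (riesz_ne_top 1 hx), lintegral_const_mul' _ _ (riesz_ne_top 2 hx)]

lemma exists_enorm_integral_alphaDot_newton_sub_le (hh : Integrable h) (hb : 3 < b) (hb' : b < 4)
    (hB : B ≠ ∞) (hbound : ∀ᵐ y, ‖h y‖ₑ ≤ B * riesz b y)
    (hfin : ∀ x : E3, ∫⁻ y, riesz 2 (x - y) * ‖h y‖ₑ ≠ ∞) :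
    ∃ K : ℝ≥0∞, K ≠ ∞ ∧ ∀ x : E3, x ≠ 0 →
      ‖(∫ y, alphaDot (newton (x - y)) *ᵥ h y) - alphaDot (newton x) *ᵥ ∫ y, h y‖ₑ ≤
        K * riesz (b - 1) x := by
  have hd : (finrank ℝ E3 : ℝ) = 3 := by simp
  obtain ⟨C₂, hC₂, hle₂⟩ := exists_lintegral_riesz_mul_riesz_le (volume : Measure E3)
    (p := 2) (q := b - 1) (by norm_num) (by rw [hd]; norm_num) (by linarith)
    (by rw [hd]; linarith) (by rw [hd]; linarith)
  obtain ⟨C₁, hC₁, hle₁⟩ := exists_lintegral_riesz_mul_riesz_le (volume : Measure E3)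
    (p := 1) (q := b - 1) (by norm_num) (by rw [hd]; norm_num) (by linarith)
    (by rw [hd]; linarith) (by rw [hd]; linarith)
  refine ⟨12 * (B * (C₂ + C₁)), by finiteness, fun x hx => ?_⟩
  calc ‖(∫ y, alphaDot (newton (x - y)) *ᵥ h y) - alphaDot (newton x) *ᵥ ∫ y, h y‖ₑ
      ≤ 12 * ∫⁻ y, ‖newton (x - y) - newton x‖ₑ * ‖h y‖ₑ := by
        rw [← integral_mulVec _ hh]
        exact enorm_integral_alphaDot_sub_le
          (integrable_alphaDot_newton_mulVec hh.aestronglyMeasurable (hfin x))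
          (integrable_mulVec _ hh)
    _ ≤ 12 * (B * (riesz 1 x * (C₂ * riesz (2 + (b - 1) - finrank ℝ E3) x) +
          riesz 2 x * (C₁ * riesz (1 + (b - 1) - finrank ℝ E3) x))) := by
        refine mul_le_mul_right ((lintegral_enorm_newton_sub_mul_le hx hB hbound).trans ?_) _
        gcongr
        · exact hle₂ x hx
        · exact hle₁ x hx
    _ = 12 * (B * (C₂ * (riesz 1 x * riesz (2 + (b - 1) - finrank ℝ E3) x) +
          C₁ * (riesz 2 x * riesz (1 + (b - 1) - finrank ℝ E3) x))) := by ring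
    _ = 12 * (B * (C₂ + C₁)) * riesz (b - 1) x := by
        rw [riesz_mul_riesz _ _ hx, riesz_mul_riesz _ _ hx, hd]
        ring_nf

lemma sq_smul_alphaDot_newton_smul {r : ℝ} (hr : 0 < r) {ω : E3} (hω : ‖ω‖ = 1) :
    ((r : ℂ) ^ 2) • alphaDot (newton (r • ω)) = alphaDot ω := by
  have hr' : (r : ℂ) ≠ 0 := Complex.ofReal_ne_zero.2 hr.ne'
  rw [newton_smul hr.le, newton, hω, one_pow, inv_one, one_smul, alphaDot_smul, smul_smul]
  push_cast
  rw [mul_inv_cancel₀ (pow_ne_zero 2 hr'), one_smul]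

lemma edist_sq_smul_diracPotential_le {r : ℝ} (hr : 0 < r) {ω : E3} (hω : ‖ω‖ = 1) {K : ℝ≥0∞}
    (hK : ‖(∫ y, alphaDot (newton (r • ω - y)) *ᵥ h y) -
      alphaDot (newton (r • ω)) *ᵥ ∫ y, h y‖ₑ ≤ K * riesz (b - 1) (r • ω)) :
    edist (((r : ℂ) ^ 2) • diracPotential h (r • ω))
        ((Complex.I / (4 * Real.pi)) • (alphaDot ω *ᵥ ∫ y, h y)) ≤
      ‖Complex.I / (4 * Real.pi)‖ₑ * K * ENNReal.ofReal (r ^ (-(b - 3))) := by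
  have hnorm : ‖r • ω‖ = r := by rw [norm_smul, hω, mul_one, Real.norm_of_nonneg hr.le]
  have hpow : ‖(r : ℂ) ^ 2‖ₑ * riesz (b - 1) (r • ω) = ENNReal.ofReal (r ^ (-(b - 3))) := by
    rw [riesz_eq_ofReal _ (norm_ne_zero_iff.1 (hnorm.trans_ne hr.ne')), hnorm, ← ofReal_norm,
      norm_pow, Complex.norm_real, Real.norm_of_nonneg hr.le,
      ← ENNReal.ofReal_mul (by positivity), ← Real.rpow_two, ← Real.rpow_add hr]
    ring_nf
  rw [edist_eq_enorm_sub, ← sq_smul_alphaDot_newton_smul hr hω, diracPotential,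
    Matrix.smul_mulVec, smul_comm (Complex.I / _), ← smul_sub, ← smul_sub, enorm_smul, enorm_smul]
  refine (mul_le_mul_right (mul_le_mul_right hK _) _).trans_eq ?_
  rw [← hpow]
  ring

lemma tendstoUniformlyOn_sq_smul_diracPotential (hh : AEStronglyMeasurable h volume)
    (hb : 3 < b) (hB : B ≠ ∞) (hbound : ∀ᵐ y, ‖h y‖ₑ ≤ B * decayWeight b y) :
    TendstoUniformlyOn (fun (r : ℝ) (ω : E3) => ((r : ℂ) ^ 2) • diracPotential h (r • ω))
      (fun ω => (Complex.I / (4 * Real.pi)) • (alphaDot ω *ᵥ ∫ y, h y)) atTop (sphere 0 1) := by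
  obtain ⟨a, ha3, ha⟩ := exists_between (lt_min hb (show (3 : ℝ) < 4 by norm_num))
  obtain ⟨hab, ha4⟩ := lt_min_iff.1 ha
  have hbound' : ∀ᵐ y, ‖h y‖ₑ ≤ B * riesz a y := hbound.mono fun y hy =>
    hy.trans (mul_le_mul_right (decayWeight_le_riesz (by linarith) hab.le y) _)
  obtain ⟨M, hM, hM_le⟩ :=
    exists_lintegral_riesz_mul_enorm_le (p := 2) (by norm_num) (by norm_num) hb hB hbound
  obtain ⟨K, hK, hle⟩ := exists_enorm_integral_alphaDot_newton_sub_le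
    (integrable_of_enorm_le_decayWeight hh hb hB hbound) ha3 ha4 hB hbound'
    fun x => ne_top_of_le_ne_top hM (hM_le x)
  set c : ℂ := Complex.I / (4 * Real.pi)
  have hlim : Tendsto (fun r : ℝ => ‖c‖ₑ * K * ENNReal.ofReal (r ^ (-(a - 3)))) atTop (𝓝 0) := by
    have hpow := ENNReal.tendsto_ofReal (tendsto_rpow_neg_atTop (show 0 < a - 3 by linarith))
    simpa using ENNReal.Tendsto.const_mul (a := ‖c‖ₑ * K) hpow (Or.inr (by finiteness))
  rw [EMetric.tendstoUniformlyOn_iff]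
  intro ε hε
  filter_upwards [hlim.eventually_lt_const hε, eventually_gt_atTop 0] with r hr hr0 ω hω
  have hω' : ‖ω‖ = 1 := by simpa using hω
  have hne : r • ω ≠ 0 := smul_ne_zero hr0.ne' (norm_ne_zero_iff.1 (by simp [hω']))
  rw [edist_comm]
  exact (edist_sq_smul_diracPotential_le hr0 hω' (hle _ hne)).trans_lt hr

end Potential

section ZeroModes

variable {Q : E3 → Matrix (Fin 4) (Fin 4) ℂ} {f : E3 → Fin 4 → ℂ} {C ρ : ℝ}

lemma one_le_bracket (y : E3) : 1 ≤ bracket y := by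
  rw [bracket, Real.one_le_sqrt]
  linarith [sq_nonneg ‖y‖]

lemma norm_le_bracket (y : E3) : ‖y‖ ≤ bracket y :=
  Real.le_sqrt_of_sq_le (by linarith)

lemma ofReal_bracket_rpow_neg_le_decayWeight (hρ : 0 ≤ ρ) (y : E3) :
    ENNReal.ofReal (bracket y ^ (-ρ)) ≤ decayWeight ρ y := by
  have hb : 0 < bracket y := one_pos.trans_le (one_le_bracket y)
  refine le_min ?_ ?_
  · rw [ENNReal.ofReal_le_one]
    exact Real.rpow_le_one_of_one_le_of_nonpos (one_le_bracket y) (by linarith)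
  · rw [riesz, ← ENNReal.ofReal_rpow_of_pos hb, ENNReal.rpow_neg, ENNReal.rpow_neg,
      ENNReal.inv_le_inv, ← ofReal_norm]
    gcongr
    exact norm_le_bracket y

lemma enorm_mulVec_le_decayWeight (hρ : 0 ≤ ρ)
    (hQ : ∀ x j k, ‖Q x j k‖ ≤ C * bracket x ^ (-ρ)) (u : Fin 4 → ℂ) (y : E3) :
    ‖Q y *ᵥ u‖ₑ ≤ ENNReal.ofReal (4 * C) * (decayWeight ρ y * ‖u‖ₑ) := by
  have hb : 0 < bracket y ^ (-ρ) :=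
    Real.rpow_pos_of_pos (one_pos.trans_le (one_le_bracket y)) _
  have hC : 0 ≤ C := nonneg_of_mul_nonneg_left ((norm_nonneg _).trans (hQ y 0 0)) hb
  calc ‖Q y *ᵥ u‖ₑ ≤ ENNReal.ofReal (4 * C * (bracket y ^ (-ρ) * ‖u‖)) := by
        rw [← ofReal_norm]
        refine ENNReal.ofReal_le_ofReal ((norm_mulVec_le (by positivity) (hQ y) u).trans_eq ?_)
        rw [Fintype.card_fin]
        ring
    _ = ENNReal.ofReal (4 * C) * (ENNReal.ofReal (bracket y ^ (-ρ)) * ‖u‖ₑ) := by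
        rw [ENNReal.ofReal_mul (by positivity), ENNReal.ofReal_mul hb.le, ofReal_norm]
    _ ≤ ENNReal.ofReal (4 * C) * (decayWeight ρ y * ‖u‖ₑ) := by
        gcongr
        exact ofReal_bracket_rpow_neg_le_decayWeight hρ y

lemma exists_enorm_neg_mulVec_le_decayWeight (hρ : 1 < ρ)
    (hQ : ∀ x j k, ‖Q x j k‖ ≤ C * bracket x ^ (-ρ)) (hf2 : MemLp f 2)
    (hf : HasDiracImage Q f 0) :
    ∃ b : ℝ, 3 < b ∧ ∃ B : ℝ≥0∞, B ≠ ∞ ∧ ∀ᵐ y, ‖-(Q y *ᵥ f y)‖ₑ ≤ B * decayWeight b y := by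
  have hQf := fun y => enorm_mulVec_le_decayWeight (by linarith) hQ (f y) y
  have hf_le : ∀ᵐ x, ‖f x‖ₑ ≤ 12 * ENNReal.ofReal (4 * C) *
      ∫⁻ y, riesz 2 (x - y) * (decayWeight ρ y * ‖f y‖ₑ) := by
    filter_upwards [ae_enorm_le_lintegral_riesz hf.neg_mulVec (by norm_num) (by finiteness) hf2]
      with x hx
    refine hx.trans ?_
    rw [mul_assoc, ← lintegral_const_mul' _ _ ENNReal.ofReal_ne_top]
    refine mul_le_mul_right (lintegral_mono fun y => ?_) _
    rw [enorm_neg, mul_left_comm]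
    gcongr
    exact hQf y
  have hf_sq : ∫⁻ y, ‖f y‖ₑ ^ 2 ≠ ∞ := by
    simpa using (lintegral_rpow_enorm_lt_top_of_eLpNorm_lt_top two_ne_zero (by finiteness)
      hf2.2).ne
  obtain ⟨b, hb, B, hB, hle⟩ := exists_decayWeight_mul_le_decayWeight (volume : Measure E3)
    (p := 2) (by norm_num) (by norm_num) (by norm_num; linarith) (by finiteness)
    hf2.1.enorm hf_sq hf_le
  refine ⟨b, by simpa using hb, ENNReal.ofReal (4 * C) * B, by finiteness, ?_⟩
  filter_upwards [hle] with y hy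
  rw [enorm_neg, mul_assoc]
  exact (hQf y).trans (mul_le_mul_right hy _)

end ZeroModes

end ZeroMode
end

open ZeroMode in
theorem theorem1p1_general (Q : E3 → Matrix (Fin 4) (Fin 4) ℂ) (C ρ : ℝ) (hρ : 1 < ρ)
    (hQ : ∀ x j k, ‖Q x j k‖ ≤ C * bracket x ^ (-ρ)) (f : E3 → Fin 4 → ℂ)
    (hf2 : MemLp f 2) (hf : HasDiracImage Q f 0) :
    Integrable (fun y => Q y *ᵥ f y) ∧
    ∃ g : E3 → Fin 4 → ℂ, Continuous g ∧ g =ᵐ[volume] f ∧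
      TendstoUniformlyOn (fun (r : ℝ) (ω : E3) => ((r : ℂ) ^ 2) • g (r • ω))
        (fun ω : E3 => (-(Complex.I / (4 * (Real.pi : ℂ)))) •
          (alphaDot ω *ᵥ (∫ y, Q y *ᵥ f y)))
        atTop (Metric.sphere (0 : E3) 1) := by
  have hh := hf.neg_mulVec.aestronglyMeasurable
  obtain ⟨b, hb, B, hB, hbound⟩ := exists_enorm_neg_mulVec_le_decayWeight hρ hQ hf2 hf
  have hint := integrable_of_enorm_le_decayWeight hh hb hB hbound
  obtain ⟨M, hM, hM_le⟩ :=
    exists_lintegral_riesz_mul_enorm_le (p := 2) (by norm_num) (by norm_num) hb hB hbound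
  have hfin := fun x => ne_top_of_le_ne_top hM (hM_le x)
  obtain ⟨K, hK⟩ := exists_holderWith_diracPotential hh hb hB hbound
  have hlim := tendstoUniformlyOn_sq_smul_diracPotential hh hb hB hbound
  refine ⟨by simpa using hint.neg, _, hK.continuous (by norm_num),
    (ae_eq_diracPotential hf.neg_mulVec one_le_two (by finiteness) hf2 (ae_of_all _ hfin)).symm, ?_⟩
  simpa only [integral_neg, Matrix.mulVec_neg, smul_neg, ← neg_smul] using hlim

/-- Elements of `H¹` are functions up to equality almost everywhere, so the pointwise values
`f(rω)` are those of the continuous representative `g`, whose existence is part of the claim. -/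
theorem theorem1p1 (Q : ZeroMode.E3 → Matrix (Fin 4) (Fin 4) ℂ) (C ρ : ℝ) (hρ : 1 < ρ)
    (hQmeas : ∀ j k, AEMeasurable (fun x => Q x j k) volume)
    (hQherm : ∀ x, (Q x).IsHermitian)
    (hQdecay : ∀ x j k, ‖Q x j k‖ ≤ C * ZeroMode.bracket x ^ (-ρ))
    (f : ZeroMode.E3 → Fin 4 → ℂ) (hf : ZeroMode.IsZeroMode Q f) :
    Integrable (fun y => Q y *ᵥ f y) volume ∧
    ∃ g : ZeroMode.E3 → Fin 4 → ℂ, Continuous g ∧ g =ᵐ[volume] f ∧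
      TendstoUniformlyOn
        (fun (r : ℝ) (ω : ZeroMode.E3) => ((r : ℂ) ^ 2) • g (r • ω))
        (fun ω : ZeroMode.E3 => (-(Complex.I / (4 * (Real.pi : ℂ)))) •
          (ZeroMode.alphaDot ω *ᵥ (∫ y, Q y *ᵥ f y)))
        atTop (Metric.sphere (0 : ZeroMode.E3) 1) :=
  theorem1p1_general Q C ρ hρ hQdecay f (MemLp.of_eval fun k => (hf.1 k).1) hf.2
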